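/- **Setting.** Let $d\in\mathbb N$, $H\in(1/2,1)$, $\theta\in(1/2,H)$, $\alpha\in(0,1/2)$, $K>0$, $\beta>(1-2\alpha)^{-1}$, $\varsigma>1$, $c_2\ge 1$, $M_1>0$. Let $b:\mathbb R^d\to\mathbb R^d$ be locally Lipschitz with at most linear growth, and let $\sigma:\mathbb R^d\to\mathbb R^{d\times d}$ be bounded and $C^1$ with bounded, $\gamma$-Hölder derivative for some $\gamma\in(1/H-1,1]$. Suppose that every $\sigma(x)$ is invertible and that $\sigma^{-1}=\nabla h$ for a $C^1$ map $h:\mathbb R^d\to\mathbb R^d$ with locally Lipschitz Jacobian (then $h$ is a diffeomorphism of $\mathbb R^d$). For $g:\mathbb R\to\mathbb R^d$ and $T\ge0$ let $(\mathcal R_Tg)(t)=\int_{-\infty}^0\frac{t^{1/2-H}(T-s)^{H-1/2}}{t+T-s}g(s)\,ds$, $t>0$, and $g^\tau(t)=g(\tau+t)$. Consider (A) $\displaystyle \sup_{T\ge0}\int_0^\infty(1+t)^{2\alpha}|(\mathcal R_Tg^\tau)(t)|^2dt\le1$ (all the integrals $(\mathcal R_Tg^\tau)(t)$ being absolutely convergent).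 Let $W^1,W^2$ be two-sided $d$-dimensional Brownian motions on a probability space, $B^i_t=\alpha_H\int_{\mathbb R}\big((t-r)_+^{H-1/2}-(-r)_+^{H-1/2}\big)dW^i_r$ the associated fractional Brownian motions ($\alpha_H>0$ normalises the variance), and $X^i$ solutions of $dX^i=b(X^i)dt+\sigma(X^i)dB^i$ (Young integral, locally $\theta$-Hölder paths). For $i=1,2$, the process $(W^i_t)_{t\ge0}$ is independent of $(X^1_0,X^2_0,(W^1_s,W^2_s)_{s\le0})$. All processes are adapted to a filtration. Assume $dW^2_t=dW^1_t+g_w(t)\,dt$ with $g_w$ a.s. locally integrable. The system is *$(K,\alpha)$-admissible* at a finite time $\tau$ if (A) holds for $g=g_w$, $|X^i_\tau|\le K$ and $\varphi_\tau(W^i)\le K$ for $i=1,2$, where $$\varphi_\tau(w)=\sup_{\tau\le s<t\le\tau+1}\frac1{t-s}\Big|\int_{-\infty}^{\tau-1}\big((t-r)^{H-\frac12}-(s-r)^{H-\frac12}\big)dw_r\Big|+\sup_{\tau-1\le s<t\le\tau}\frac{|w_t-w_s|}{(t-s)^{\frac12-\frac{H-\theta}2}}.$$ *Constants of Step 1.*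 Fix $a\ge K$, a bounded Lipschitz $b_a$ equal to $b$ on $\bar B(0,a)$, and a $C^1$-diffeomorphism $\varpi_a$ onto its image with $\varpi_a=\mathrm{Id}$ on $\bar B(0,a)$, $|\varpi_a|\le a+1$ and bounded Lipschitz Jacobian. Put $h_a=h\circ\varpi_a$, $G=(\nabla h_a\,b_a)\circ h^{-1}$, $\kappa_1=\sup_{y_1\ne y_2}|G(y_2)-G(y_1)|/|y_2-y_1|$, $\kappa_2=4\big(\sup_{|x|,|y|\le K}|h(y)-h(x)|\big)^{1/2}$, $f(\rho)=-\kappa_1\rho-\kappa_2\rho/\sqrt{|\rho|}$ ($f(0)=0$), $C_H=\sin(\pi(H-\tfrac12))/\pi$. *The coupling scheme.* There are stopping times $\tau_k\in[0,\infty]$, $k\ge 0$, with $\tau_0<\infty$ a.s.; $W^1=W^2$ and $g_w=0$ on $(-\infty,\tau_0]$; if $\tau_{k-1}=\infty$ then $\tau_k=\infty$. Trial $k\ge1$ starts at $\tau=\tau_{k-1}$ when this is finite, and almost surely runs as follows. * **Step 1**, on $[\tau,\tau+1]$. If the system is not admissible at $\tau$, then $g_w=0$ there. If it is, the innovations $w_i=W^i_{\tau+\cdot}-W^i_\tau$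 on $[0,1]$ satisfy one of $w_2=\phi(w_1)$, $w_1=\phi(w_2)$, $w_1=w_2$, where $\phi(w)(t)=w(t)+\int_0^tg_h(s)ds$ and $g_h$ is given as follows: let $B^w$ be the fractional path driven by $W^1$ up to $\tau$ and by the innovation $w$ afterwards, let $y$ solve $y(t)=h_a(X^1_\tau)+\int_0^tG(y(s))ds+B^w_{\tau+t}-B^w_\tau$, let $\rho$ solve $\rho(t)=h_a(X^2_\tau)-h_a(X^1_\tau)+\int_0^t\big(G(y+\rho)-G(y)+f(\rho)\big)(s)\,ds$, and $$g_h(t)=-C_H(\mathcal R_0g_w^\tau)(t)+\frac{C_H}{\alpha_H(H-\frac12)}\frac{d}{dt}\int_0^t(t-s)^{\frac12-H}f(\rho(s))\,ds .$$ Step 1 succeeds if the system is admissible at $\tau$ and $X^1_{\tau+1}=X^2_{\tau+1}$. * **Step 2**, after a success of Step 1, is a series of attempts $\ell=1,2,\dots$ on $[s_\ell,s_{\ell+1}]$, with $s_1=\tau+1$, $s_{\ell+1}=s_\ell+c_22^\ell$. Let $g_S(\tau+1+t)=-C_H(\mathcal R_0g_w^{\tau+1})(t)$, $t>0$, be the drift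 which makes $B^2-B^1$ constant after $\tau+1$. As long as all previous attempts succeeded, on $[s_\ell,s_{\ell+1}]$ $$W^i_t-W^i_{s_\ell}=U_i\,\frac{\int_{s_\ell}^tg_S(r)dr}{A_\ell}+Z_t,\quad i=1,2,\qquad A_\ell=\Big(\int_{s_\ell}^{s_{\ell+1}}|g_S|^2\Big)^{1/2}$$ (the quotient being $0$ if $A_\ell=0$), with $Z$ common to both, and with $U_2=U_1+A_\ell$, or $U_2=U_1$, or ($U_2=-U_1$ and $|U_1|\le M_\ell/2$), where $M_\ell=\max\{4b_\ell,-2\log(b_\ell/8)\}$, $b_\ell=2^{-\alpha\ell}$, for $\ell\ge2$. The attempt succeeds if $g_w=g_S$ a.e. on the interval. * **Step 3.** If the first failure is that of attempt $\ell$ of Step 2 (or of Step 1, in which case $\ell=0$ and $s_1=\tau+1$), then $g_w=0$ on $[s_{\ell+1},\tau_k]$ and $\tau_k=s_{\ell+1}+\Delta_3(\ell,k)$ with $\Delta_3(\ell,k)=c_3\,\varsigma^k\,2^{\beta\ell}$. If nothing fails, $\tau_k=+\infty$. **Proposition.** For all the data above (in particular for each $K>0$), there is a choice of the constant $c_3\ge2c_2$,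 depending only on the deterministic data $d,H,\theta,\alpha,K,\beta,\varsigma,c_2,M_1,b,\sigma,h,a,\varpi_a,b_a$, such that for every realisation of this coupling scheme and every $k\ge0$, condition (A) with $g=g_w$ and $\tau=\tau_k$ holds almost surely on $\{\tau_k<\infty\}$. In other words, $\mathbb P\big(\text{(A) holds at }\tau_k\,\big|\,\tau_k<\infty\big)=1$ for every $k\ge0$ with $\mathbb P(\tau_k<\infty)>0$. -/

import Mathlib

open MeasureTheory ProbabilityTheory Set
open scoped NNReal ENNReal

noncomputable section

namespace FracCoupling

/-- Euclidean space of dimension `d`. -/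
abbrev Vec (d : ℕ) := EuclideanSpace ℝ (Fin d)

/-! ### The memory operator and fractional Brownian paths -/

/-- The kernel `t^(1/2-H) (T-s)^(H-1/2) / (t+T-s)`. -/
def memKernel (H T t s : ℝ) : ℝ :=
  t ^ (1 / 2 - H) * (T - s) ^ (H - 1 / 2) / (t + T - s)

/-- The operator `(R_T g)(t) = ∫_{-∞}^0 t^(1/2-H) (T-s)^(H-1/2) / (t+T-s) g(s) ds`. -/
def memOp {d : ℕ} (H T : ℝ) (g : ℝ → Vec d) (t : ℝ) : Vec d :=
  ∫ s in Iic (0 : ℝ), memKernel H T t s • g s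

/-- The cost condition `sup_{T ≥ 0} ∫_0^∞ (1+t)^(2α) |(R_T g)(t)|² dt ≤ 1`, including the
requirement that every `(R_T g)(t)`, `t > 0`, is an absolutely convergent integral. -/
def MemoryCond {d : ℕ} (H α : ℝ) (g : ℝ → Vec d) : Prop :=
  (∀ T : ℝ, 0 ≤ T → ∀ t : ℝ, 0 < t →
    IntegrableOn (fun s => memKernel H T t s • g s) (Iic (0 : ℝ))) ∧
  (⨆ T : ℝ≥0, ∫⁻ t in Ioi (0 : ℝ),
    ENNReal.ofReal ((1 + t) ^ (2 * α)) * ‖memOp H (T : ℝ) g t‖ₑ ^ 2) ≤ 1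

/-- The normalisation `α_H` in the Mandelbrot-Van Ness representation (it makes the variance of
each coordinate at time one equal to one). -/
def alphaH (H : ℝ) : ℝ :=
  (1 / (2 * H) + ∫ s in Ioi (0 : ℝ), ((1 + s) ^ (H - 1 / 2) - s ^ (H - 1 / 2)) ^ 2) ^ (-(1 / 2) : ℝ)

/-- The Mandelbrot-Van Ness representation `α_H ∫ ((t-r)_+^(H-1/2) - (-r)_+^(H-1/2)) dw_r`
(equal to `α_H ∫_{-∞}^0 (-r)^(H-1/2) (dw_{r+t} - dw_r)`) of a continuous path `w` with `w 0 = 0`,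
for `1/2 < H < 1`. The Wiener integral is written, after an integration by parts, as an absolutely
convergent pathwise integral; the boundary terms vanish for almost every Brownian path.
Note that `0 ^ (H - 3/2) = 0` here. -/
def mvn {d : ℕ} (H : ℝ) (w : ℝ → Vec d) (t : ℝ) : Vec d :=
  (alphaH H * (H - 1 / 2)) •
    ∫ r : ℝ, ((max (t - r) 0) ^ (H - 3 / 2) - (max (-r) 0) ^ (H - 3 / 2)) • w r

/-- The integral `∫_{-∞}^c ((t-r)^(H-1/2) - (s-r)^(H-1/2)) dw_r` for `c < s ≤ t`, again integrated
by parts (so that it can be evaluated pathwise, at random `c`, `s`, `t`). -/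
def pastIntegral {d : ℕ} (H : ℝ) (w : ℝ → Vec d) (c s t : ℝ) : Vec d :=
  ((t - c) ^ (H - 1 / 2) - (s - c) ^ (H - 1 / 2)) • w c +
    (H - 1 / 2) • ∫ r in Iic c, ((t - r) ^ (H - 3 / 2) - (s - r) ^ (H - 3 / 2)) • w r

/-- The functional `φ_{τ,ε}(w)`: the Lipschitz seminorm on `[τ, τ+1]` of the contribution of
`w` before time `τ - 1`, plus the `(1/2 - ε)`-Hölder seminorm of `w` on `[τ - 1, τ]`. -/
def pastSize {d : ℕ} (H ε τ : ℝ) (w : ℝ → Vec d) : ℝ≥0∞ :=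
  (⨆ (s : ℝ) (t : ℝ) (_ : τ ≤ s ∧ s < t ∧ t ≤ τ + 1),
    ENNReal.ofReal (‖pastIntegral H w (τ - 1) s t‖ / (t - s))) +
  (⨆ (s : ℝ) (t : ℝ) (_ : τ - 1 ≤ s ∧ s < t ∧ t ≤ τ),
    ENNReal.ofReal (‖w t - w s‖ / (t - s) ^ (1 / 2 - ε)))

/-! ### The stochastic differential equation -/

/-- The assumption on the coefficients: `b` is locally Lipschitz with at most linear growth, `σ` is
bounded, `C¹`, with bounded and `γ`-Hölder derivative for some `γ ∈ (1/H - 1, 1]`. -/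
def RegularCoefficients {d : ℕ} (H : ℝ) (b : Vec d → Vec d) (σ : Vec d → Vec d →L[ℝ] Vec d) :
    Prop :=
  LocallyLipschitz b ∧ (∃ C : ℝ, ∀ x, ‖b x‖ ≤ C * (1 + ‖x‖)) ∧
  ContDiff ℝ 1 σ ∧
  ∃ γ ∈ Ioc (1 / H - 1) 1, ∃ C : ℝ, ∀ x y,
    ‖σ x‖ ≤ C ∧ ‖fderiv ℝ σ x‖ ≤ C ∧ ‖fderiv ℝ σ x - fderiv ℝ σ y‖ ≤ C * ‖x - y‖ ^ γ

/-- `σ(x)` is invertible for every `x` and `σ⁻¹` is the Jacobian of the `C¹` map `h`, with a locally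
Lipschitz Jacobian. -/
def IsJacobianInverse {d : ℕ} (σ : Vec d → Vec d →L[ℝ] Vec d) (h : Vec d → Vec d) : Prop :=
  ContDiff ℝ 1 h ∧ LocallyLipschitz (fderiv ℝ h) ∧
  ∀ x, (fderiv ℝ h x).comp (σ x) = ContinuousLinearMap.id ℝ (Vec d) ∧
    (σ x).comp (fderiv ℝ h x) = ContinuousLinearMap.id ℝ (Vec d)

/-- `I` is the Young integral `∫_s^t f dB`: the limit of the left-point Riemann sums as the mesh of
the subdivision tends to zero. -/
def HasYoungIntegral {d : ℕ} (f : ℝ → Vec d →L[ℝ] Vec d) (B : ℝ → Vec d) (s t : ℝ) (I : Vec d) :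
    Prop :=
  ∀ ε > 0, ∃ δ > 0, ∀ (n : ℕ) (u : ℕ → ℝ), Monotone u → u 0 = s → u n = t →
    (∀ i < n, u (i + 1) - u i ≤ δ) →
    ‖(∑ i ∈ Finset.range n, f (u i) (B (u (i + 1)) - B (u i))) - I‖ ≤ ε

/-- `X` is a solution on `[0, ∞)`, with locally `θ`-Hölder paths, of `dX = b(X) dt + σ(X) dB`. -/
def IsSolution {d : ℕ} (θ : ℝ) (b : Vec d → Vec d) (σ : Vec d → Vec d →L[ℝ] Vec d)
    (X B : ℝ → Vec d) : Prop :=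
  (∀ T > 0, ∃ C : ℝ, ∀ s ∈ Icc 0 T, ∀ t ∈ Icc 0 T, ‖X t - X s‖ ≤ C * |t - s| ^ θ) ∧
  ∀ t ≥ 0, HasYoungIntegral (fun s => σ (X s)) B 0 t (X t - X 0 - ∫ s in (0 : ℝ)..t, b (X s))

/-- `W` is a two-sided `d`-dimensional Brownian motion with `W 0 = 0`. -/
structure IsTwoSidedBM {d : ℕ} {Ω : Type*} {mΩ : MeasurableSpace Ω} (P : Measure Ω)
    (W : ℝ → Ω → Vec d) : Prop where
  measurable : ∀ t, Measurable (W t)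
  zero : ∀ᵐ ω ∂P, W 0 ω = 0
  continuous : ∀ᵐ ω ∂P, Continuous fun t => W t ω
  indep_increments : HasIndepIncrements W P
  law : ∀ s t : ℝ, s ≤ t → HasLaw (fun ω => W t ω - W s ω)
    ((stdGaussian (Vec d)).map fun x => Real.sqrt (t - s) • x) P

/-! ### Parameters of the coupling scheme -/

/-- The deterministic data of the coupling scheme, apart from the constant `c₃`. -/
structure Params (d : ℕ) where
  /-- Hurst parameter -/
  H : ℝ
  /-- Hölder exponent -/
  θ : ℝ
  /-- exponents and size in the `(K,α)`-admissibility condition -/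
  α : ℝ
  K : ℝ
  /-- parameters of the durations in Steps 2 and 3 -/
  β : ℝ
  ς : ℝ
  c₂ : ℝ
  /-- truncation level of the Gaussian coupling used in the first attempt of Step 2 -/
  M₁ : ℝ
  /-- drift, diffusion coefficient, and the map with Jacobian `σ⁻¹` -/
  b : Vec d → Vec d
  σ : Vec d → Vec d →L[ℝ] Vec d
  h : Vec d → Vec d
  /-- radius of the localisation, localising map and localised drift -/
  a : ℝ
  ϖ : Vec d → Vec d
  bLoc : Vec d → Vec d

/-- Localisation at radius `a`: `ϖ` is a bounded `C¹` diffeomorphism onto its image, equal to the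
identity on the closed ball of radius `a`, with norm at most `a + 1` and with bounded and Lipschitz
Jacobian; `bLoc` is bounded, Lipschitz and equal to `b` on that ball. -/
structure IsLocalization {d : ℕ} (a : ℝ) (b ϖ bLoc : Vec d → Vec d) : Prop where
  contDiff : ContDiff ℝ 1 ϖ
  injective : Function.Injective ϖ
  regular : ∀ x, Function.Bijective (fderiv ℝ ϖ x)
  eq_id : ∀ x, ‖x‖ ≤ a → ϖ x = x
  bound : ∀ x, ‖ϖ x‖ ≤ a + 1
  jacobian_bound : ∃ C : ℝ, ∀ x, ‖fderiv ℝ ϖ x‖ ≤ C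
  jacobian_lipschitz : ∃ L : ℝ≥0, LipschitzWith L (fderiv ℝ ϖ)
  drift_bound : ∃ C : ℝ, ∀ x, ‖bLoc x‖ ≤ C
  drift_lipschitz : ∃ L : ℝ≥0, LipschitzWith L bLoc
  drift_eq : ∀ x, ‖x‖ ≤ a → bLoc x = b x

/-- Standing assumptions on the parameters. -/
structure Params.Valid {d : ℕ} (p : Params d) : Prop where
  hH : p.H ∈ Ioo (1 / 2) 1
  hθ : p.θ ∈ Ioo (1 / 2) p.H
  hα : p.α ∈ Ioo 0 (1 / 2)
  hK : 0 < p.K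
  hβ : (1 - 2 * p.α)⁻¹ < p.β
  hς : 1 < p.ς
  hc₂ : 1 ≤ p.c₂
  hM₁ : 0 < p.M₁
  coefficients : RegularCoefficients p.H p.b p.σ
  jacobian : IsJacobianInverse p.σ p.h
  ha : p.K ≤ p.a
  localization : IsLocalization p.a p.b p.ϖ p.bLoc

/-- Duration of Step 3 of trial `k` when it follows the failure of attempt `ℓ` of Step 2
(`ℓ = 0`: failure of Step 1). -/
def Params.stepThreeLength {d : ℕ} (p : Params d) (c₃ : ℝ) (ℓ k : ℕ) : ℝ :=
  c₃ * p.ς ^ k * (2 : ℝ) ^ (p.β * ℓ)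

/-! ### Paths of the coupled system and admissibility -/

/-- One realisation of the coupled system: the two driving Brownian paths, the two solutions
(indexed by `0`, `1`) and the drift `g = g_w` with `dW² = dW¹ + g dt`. -/
structure Paths (d : ℕ) where
  W : Fin 2 → ℝ → Vec d
  X : Fin 2 → ℝ → Vec d
  g : ℝ → Vec d

/-- `(K,α)`-admissibility of the system at the finite time `τ`. -/
def Admissible {d : ℕ} (p : Params d) (q : Paths d) (τ : ℝ) : Prop :=
  MemoryCond p.H p.α (fun s => q.g (s + τ)) ∧
  ∀ i, ‖q.X i τ‖ ≤ p.K ∧ pastSize p.H ((p.H - p.θ) / 2) τ (q.W i) ≤ ENNReal.ofReal p.K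

/-! ### Step 1 -/

namespace Params

variable {d : ℕ} (p : Params d)

/-- `h_a = h ∘ ϖ_a` -/
def hLoc (x : Vec d) : Vec d := p.h (p.ϖ x)

/-- `(∇h_a b_a)(h⁻¹(y))` -/
def driftLoc (y : Vec d) : Vec d :=
  fderiv ℝ p.hLoc (Function.invFun p.h y) (p.bLoc (Function.invFun p.h y))

/-- `κ₁`, the Lipschitz constant of `(∇h_a b_a) ∘ h⁻¹` -/
def κ₁ : ℝ := ⨆ z : Vec d × Vec d, ‖p.driftLoc z.2 - p.driftLoc z.1‖ / ‖z.2 - z.1‖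

/-- `κ₂ = 4 (sup_{x, y ∈ B(0,K)} |h(y) - h(x)|)^(1/2)` -/
def κ₂ : ℝ :=
  4 * Real.sqrt (sSup {r | ∃ x y : Vec d, ‖x‖ ≤ p.K ∧ ‖y‖ ≤ p.K ∧ r = ‖p.h y - p.h x‖})

/-- `-κ₁ ρ - κ₂ ρ / √|ρ|`, equal to zero at `ρ = 0` -/
def feedback (ρ : Vec d) : Vec d := -(p.κ₁ • ρ) - p.κ₂ • ((Real.sqrt ‖ρ‖)⁻¹ • ρ)

/-- The constant `sin(π(H-1/2))/π` of Abel's inversion formula. -/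
def abelConst : ℝ := Real.sin (Real.pi * (p.H - 1 / 2)) / Real.pi

end Params

/-- The path equal to `V` up to time `τ` and continued by the innovation `w`. -/
def glue {d : ℕ} (V : ℝ → Vec d) (τ : ℝ) (w : ℝ → Vec d) (r : ℝ) : Vec d :=
  if r ≤ τ then V r else V τ + w (r - τ)

/-- The innovation of a path `V` after time `τ`. -/
def innovation {d : ℕ} (V : ℝ → Vec d) (τ u : ℝ) : Vec d := V (u + τ) - V τ

/-- `gh` is (on `(0,1]`) the drift `g_h` attached in Step 1, begun at time `τ`, to the innovation
`w`; thus the map `φ` of Step 1 is `φ(w)(t) = w(t) + ∫_0^t gh(s) ds`.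

Here `y` is the companion of `h_a(x¹)`, driven by the fractional path that has the past of `W¹` and
the innovation `w`; `ρ` is the difference of the two companions; and
`f = -κ₁ ρ - κ₂ ρ/√|ρ|` is the drift between the two fractional paths. The last line is the
inversion formula giving the drift `gh` of the Brownian paths on `(0,1]` for which the fractional
paths have the drift `f` on `[0,1]`. -/
def IsStepOneDrift {d : ℕ} (p : Params d) (q : Paths d) (τ : ℝ) (w gh : ℝ → Vec d) : Prop :=
  ∃ y ρ : ℝ → Vec d, ContinuousOn y (Icc 0 1) ∧ ContinuousOn ρ (Icc 0 1) ∧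
    (∀ t ∈ Icc (0 : ℝ) 1, y t = p.hLoc (q.X 0 τ) + (∫ s in (0 : ℝ)..t, p.driftLoc (y s)) +
      (mvn p.H (glue (q.W 0) τ w) (τ + t) - mvn p.H (glue (q.W 0) τ w) τ)) ∧
    (∀ t ∈ Icc (0 : ℝ) 1, ρ t = (p.hLoc (q.X 1 τ) - p.hLoc (q.X 0 τ)) +
      ∫ s in (0 : ℝ)..t,
        (p.driftLoc (y s + ρ s) - p.driftLoc (y s) + p.feedback (ρ s))) ∧
    ∀ᵐ t ∂volume.restrict (Ioc (0 : ℝ) 1),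
      gh t = -(p.abelConst • memOp p.H 0 (fun s => q.g (s + τ)) t) +
        (p.abelConst / (alphaH p.H * (p.H - 1 / 2))) •
          deriv (fun r => ∫ s in (0 : ℝ)..r, (r - s) ^ (1 / 2 - p.H) • p.feedback (ρ s)) t

/-- Step 1, begun at time `τ`. It is attempted only if the system is admissible. The coupling of
the innovations `(w₁, w₂)` on `[0,1]` is carried by the graph `w₂ = φ(w₁)`, its transpose
`w₁ = φ(w₂)`, and the diagonal. -/
def StepOne {d : ℕ} (p : Params d) (q : Paths d) (τ : ℝ) : Prop :=
  (¬ Admissible p q τ → ∀ᵐ t ∂volume.restrict (Ioc τ (τ + 1)), q.g t = 0) ∧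
  (Admissible p q τ →
    IsStepOneDrift p q τ (innovation (q.W 0) τ) (fun t => q.g (t + τ)) ∨
    IsStepOneDrift p q τ (innovation (q.W 1) τ) (fun t => -q.g (t + τ)) ∨
    ∀ᵐ t ∂volume.restrict (Ioc τ (τ + 1)), q.g t = 0)

/-- Step 1 is successful: it has been attempted and the positions agree at time `τ + 1`. -/
def StepOneSucceeds {d : ℕ} (p : Params d) (q : Paths d) (τ : ℝ) : Prop :=
  Admissible p q τ ∧ q.X 0 (τ + 1) = q.X 1 (τ + 1)

/-! ### Step 2 -/

/-- Beginning `s_ℓ` of attempt `ℓ` of Step 2 in the trial begun at `τ`: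
`s_0 = s_1 = τ + 1`, `s_{ℓ+1} = s_ℓ + c₂ 2^ℓ` for `ℓ ≥ 1`. -/
def attemptStart (c₂ τ : ℝ) : ℕ → ℝ
  | 0 => τ + 1
  | 1 => τ + 1
  | (n + 2) => attemptStart c₂ τ (n + 1) + c₂ * 2 ^ (n + 1)

/-- The drift `g_S` after time `τ + 1` that keeps the two fractional paths, hence the two
solutions, together after time `τ + 1`: the drift between the fractional paths vanishes after
`τ + 1` if and only if `g_w = g_S` there. -/
def stickyDrift {d : ℕ} (p : Params d) (q : Paths d) (τ t : ℝ) : Vec d :=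
  -(p.abelConst • memOp p.H 0 (fun s => q.g (s + (τ + 1))) (t - (τ + 1)))

/-- Attempt `ℓ ≥ 1` of Step 2 succeeds. -/
def AttemptSucceeds {d : ℕ} (p : Params d) (q : Paths d) (τ : ℝ) (ℓ : ℕ) : Prop :=
  ∀ᵐ t ∂volume.restrict (Ioc (attemptStart p.c₂ τ ℓ) (attemptStart p.c₂ τ (ℓ + 1))),
    q.g t = stickyDrift p q τ t

/-- Attempt `ℓ ≥ 1` of Step 2 takes place: Step 1 and all previous attempts succeeded. -/
def AttemptOccurs {d : ℕ} (p : Params d) (q : Paths d) (τ : ℝ) (ℓ : ℕ) : Prop :=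
  StepOneSucceeds p q τ ∧ ∀ i, 1 ≤ i → i < ℓ → AttemptSucceeds p q τ i

/-- `ℓ* = n` for the trial begun at `τ`: the first failure is that of attempt `n` of Step 2, or of
Step 1 if `n = 0`. -/
def FailsAt {d : ℕ} (p : Params d) (q : Paths d) (τ : ℝ) : ℕ → Prop
  | 0 => ¬ StepOneSucceeds p q τ
  | (n + 1) => AttemptOccurs p q τ (n + 1) ∧ ¬ AttemptSucceeds p q τ (n + 1)

/-- The three lines that carry the coupling `(U₁, U₂)` of two standard Gaussian variables with
shift `a` and truncation level `M`: the common part `min(φ(x), φ(x+a)) dx` of the two laws sits on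
`y = x + a`, the rest of the mass in `[-M/2, M/2]` on `y = -x`, the rest of the mass outside
`[-M/2, M/2]` on `y = x`. -/
def gaussLines (a M : ℝ) : Set (ℝ × ℝ) :=
  {u | u.2 = u.1 + a} ∪ {u | u.2 = -u.1 ∧ |u.1| ≤ M / 2} ∪ {u | u.2 = u.1}

/-- Truncation level in attempt `ℓ` of Step 2: `M₁` for `ℓ = 1`, and `max (4 b) (-2 log (b/8))` with
`b = 2^(-αℓ)` for `ℓ ≥ 2`. -/
def Params.truncation {d : ℕ} (p : Params d) (ℓ : ℕ) : ℝ :=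
  if ℓ ≤ 1 then p.M₁ else
    max (4 * (2 : ℝ) ^ (-(p.α * ℓ))) (-2 * Real.log ((2 : ℝ) ^ (-(p.α * ℓ)) / 8))

/-- The coupling in attempt `ℓ` of Step 2. On the interval `[s_ℓ, s_{ℓ+1}]` the component of the
innovation of `Wⁱ` along the unit vector `g_S / ‖g_S‖` of `L²` is `U i`, the rest `Z` of the
innovation is the same for both, and `(U 0, U 1)` lies on the lines of the Gaussian coupling with
shift `‖g_S‖`. -/
def StepTwoAttempt {d : ℕ} (p : Params d) (q : Paths d) (τ : ℝ) (ℓ : ℕ) : Prop :=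
  let s := attemptStart p.c₂ τ ℓ
  let s' := attemptStart p.c₂ τ (ℓ + 1)
  let a := Real.sqrt (∫ t in s..s', ‖stickyDrift p q τ t‖ ^ 2)
  ∃ (U : Fin 2 → ℝ) (Z : ℝ → Vec d), (U 0, U 1) ∈ gaussLines a (p.truncation ℓ) ∧
    ∀ i, ∀ t ∈ Icc s s',
      q.W i t - q.W i s = U i • (a⁻¹ • ∫ r in s..t, stickyDrift p q τ r) + Z t

/-! ### Trials and the whole scheme -/

/-- Trial `k ≥ 1`, begun at the finite time `τ = τ_{k-1}` and ended at `τ' = τ_k`. -/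
structure FollowsTrial {d : ℕ} (p : Params d) (c₃ : ℝ) (k : ℕ) (q : Paths d)
    (τ : ℝ≥0) (τ' : WithTop ℝ≥0) : Prop where
  stepOne : StepOne p q τ
  stepTwo : ∀ ℓ, 1 ≤ ℓ → AttemptOccurs p q τ ℓ → StepTwoAttempt p q τ ℓ
  /-- if attempt `ℓ` fails, Step 3 begins at `s_{ℓ+1}`; the drift vanishes during Step 3 -/
  stepThree : ∀ ℓ, FailsAt p q τ ℓ → ∃ t : ℝ≥0, τ' = t ∧
    (t : ℝ) = attemptStart p.c₂ τ (ℓ + 1) + p.stepThreeLength c₃ ℓ k ∧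
    ∀ᵐ r ∂volume.restrict (Ioc (attemptStart p.c₂ τ (ℓ + 1)) (t : ℝ)), q.g r = 0
  success : (∀ ℓ, ¬ FailsAt p q τ ℓ) → τ' = ⊤

/-- The coupled system `(W¹, W²)`, `(X¹, X²)` (indexed by `0`, `1`), with drift `g` and trial times
`τ 0 ≤ τ 1 ≤ ⋯`, is a realisation of the coupling scheme. -/
structure IsCouplingScheme {d : ℕ} {Ω : Type*} {mΩ : MeasurableSpace Ω} (p : Params d) (c₃ : ℝ)
    (P : Measure Ω) (𝓕 : Filtration ℝ≥0 mΩ) (W X : Fin 2 → ℝ → Ω → Vec d) (g : ℝ → Ω → Vec d)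
    (τ : ℕ → Ω → WithTop ℝ≥0) : Prop where
  brownian : ∀ i, IsTwoSidedBM P (W i)
  adapted_noise : ∀ i (t : ℝ≥0) (u : ℝ), u ≤ t → Measurable[𝓕 t] (W i u)
  adapted : ∀ i (t : ℝ≥0), Measurable[𝓕 t] (X i t)
  /-- the noise after time zero is independent of the initial positions and of the past noise -/
  initial : ∀ i, Indep
    ((⨆ j, MeasurableSpace.comap (X j 0) inferInstance) ⊔
      ⨆ (j) (u : ℝ) (_ : u ≤ 0), MeasurableSpace.comap (W j u) inferInstance)
    (⨆ (t : ℝ) (_ : 0 ≤ t), MeasurableSpace.comap (W i t) inferInstance) P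
  solution : ∀ i, ∀ᵐ ω ∂P,
    IsSolution p.θ p.b p.σ (fun t => X i t ω) (mvn p.H fun t => W i t ω)
  /-- `dW² = dW¹ + g dt` -/
  drift : ∀ᵐ ω ∂P, LocallyIntegrable (fun t => g t ω) ∧
    ∀ s t : ℝ, W 1 t ω - W 1 s ω = W 0 t ω - W 0 s ω + ∫ r in s..t, g r ω
  stopping : ∀ k, IsStoppingTime 𝓕 (τ k)
  start_finite : ∀ᵐ ω ∂P, τ 0 ω ≠ ⊤
  /-- the two Brownian motions coincide up to the beginning of the first trial -/
  start : ∀ᵐ ω ∂P, ∀ t : ℝ≥0, τ 0 ω = t →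
    (∀ s : ℝ, s ≤ t → W 0 s ω = W 1 s ω) ∧
    ∀ᵐ s ∂volume.restrict (Iic (t : ℝ)), g s ω = 0
  trial : ∀ᵐ ω ∂P, ∀ (k : ℕ) (t : ℝ≥0), τ k ω = t →
    FollowsTrial p c₃ (k + 1) ⟨fun i s => W i s ω, fun i s => X i s ω, fun s => g s ω⟩
      t (τ (k + 1) ω)
  absorbed : ∀ᵐ ω ∂P, ∀ k, τ k ω = ⊤ → τ (k + 1) ω = ⊤

end FracCoupling

end

/-!
The statement is pathwise: of the probabilistic structure only the almost sure properties of the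
paths are used, and condition (A) at `τ_k` follows from a bound, in terms of the parameters only, of
the drift `g` of each of the trials `1, …, k`, all of which failed.

*Size of a trial.* In a trial that fails at attempt `ℓ`, the `L¹` norm of `g` is at most
`C (1 + ℓ) 2^(ℓ/2)` (`Params.Valid.lintegral_trial_le`). If the system is not admissible, `g` is
zero. Otherwise (A) at the beginning of the trial bounds the memory terms.
In Step 1, the difference `ρ` of the companions has decreasing norm, since `κ₁` is a Lipschitz
constant of the drift, and the feedback is Lipschitz in time along `ρ`, so that its fractional
derivative of order `H - 1/2` is integrable (`norm_deriv_fractional_integral_le`). That the supremum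
`κ₁` is finite rests on `h` having a Lipschitz inverse, by the global inverse function theorem
`bijective_of_jacobian_inverse`. In Step 2, the sticky drift is `R_1` of the drift before `τ`, which
(A) controls, plus the memory of Step 1, and `R_0` is bounded on `L¹`
(`lintegral_memOp_add_one_le`). In the failing attempt, `g` is a multiple of the sticky drift: the
multiple is `0` or `1`, or the `L²` norm of `g` is at most the truncation level `M_ℓ = O(ℓ)`
(`lintegral_attempt_le`).

*Damping.* Step 3 keeps the drift of trial `j` at distance at least `D = c₃ ς^j 2^(β ℓ)` from
`τ_k`. Where `s ≤ -D` the kernel of `R_T` is at most `D^(-e)` times a profile in `t`, uniformly in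
`T ≥ 0`, and for `e < 1/2 - α` this profile is in the weighted `L²` space of (A) (`memKernel_le`,
`lintegral_memProfile`). Since `β > (1 - 2α)⁻¹`, `e` can be taken larger than `1/(2β)`, and then
`2^(-e β ℓ)` absorbs `(1 + ℓ) 2^(ℓ/2)`. The trials thus contribute at most `C c₃^(-e) ς^(-e j)`
each; the sum over `j` is geometric and is made small by taking `c₃` large.
-/

namespace FracCoupling

/-! ### A global inverse function theorem -/

section Hadamard

lemma lipschitzWith_clm_apply {E F : Type*} [NormedAddCommGroup E] [NormedAddCommGroup F]
    [NormedSpace ℝ F] {σ : E → F →L[ℝ] F} {K : ℝ≥0} (hσ : LipschitzWith K σ) (v : F) :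
    LipschitzWith (K * ‖v‖₊) (fun x => σ x v) := by
  refine LipschitzWith.of_dist_le_mul fun x y => ?_
  rw [dist_eq_norm, ← sub_apply]
  calc ‖(σ x - σ y) v‖ ≤ ‖σ x - σ y‖ * ‖v‖ := ContinuousLinearMap.le_opNorm _ _
    _ ≤ (K * dist x y) * ‖v‖ := by
        gcongr; rw [← dist_eq_norm]; exact hσ.dist_le_mul x y
    _ = _ := by push_cast; ring

variable {E : Type*} [NormedAddCommGroup E] [NormedSpace ℝ E] [CompleteSpace E]

/-- The line `t ↦ h x₀ + t v` lifts through `h`: the lift solves `γ' = σ(γ) v`, where `σ` is the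
inverse Jacobian, and this equation does not blow up because `σ` is bounded. -/
lemma exists_lift_segment {σ : E → E →L[ℝ] E} {h : E → E} {K C : ℝ≥0}
    (hσ : LipschitzWith K σ) (hC : ∀ x, ‖σ x‖ ≤ C) (hh : Differentiable ℝ h)
    (hinv : ∀ x, (fderiv ℝ h x).comp (σ x) = ContinuousLinearMap.id ℝ E) (x₀ v : E) :
    ∃ γ : ℝ → E, γ 0 = x₀ ∧
      (∀ t ∈ Icc (0 : ℝ) 1, HasDerivWithinAt γ (σ (γ t) v) (Icc 0 1) t) ∧
      h (γ 1) = h x₀ + v ∧ ‖γ 1 - x₀‖ ≤ C * ‖v‖ := by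
  have hlip := lipschitzWith_clm_apply hσ v
  have hbd : ∀ x, ‖σ x v‖ ≤ (C * ‖v‖₊ : ℝ≥0) := fun x => by
    push_cast
    exact (ContinuousLinearMap.le_opNorm _ _).trans (by gcongr; exact hC x)
  have hpl : IsPicardLindelof (fun _ => fun x => σ x v) (⟨0, by simp⟩ : Icc (0 : ℝ) 1) x₀
      (C * ‖v‖₊) 0 (C * ‖v‖₊) (K * ‖v‖₊) :=
    IsPicardLindelof.of_time_independent (fun x _ => hbd x) hlip.lipschitzOnWith (by simp)
  obtain ⟨γ, h0, hγ⟩ := hpl.exists_eq_forall_mem_Icc_hasDerivWithinAt₀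
  have h0 : γ 0 = x₀ := h0
  refine ⟨γ, h0, hγ, ?_, ?_⟩
  · have hd : ∀ t ∈ Icc (0 : ℝ) 1, HasDerivWithinAt (fun t => h (γ t) - t • v) 0 (Icc 0 1) t := by
      intro t ht
      have h1 := (hh (γ t)).hasFDerivAt.comp_hasDerivWithinAt t (hγ t ht)
      have h2 : fderiv ℝ h (γ t) (σ (γ t) v) = v := by
        simpa using congrArg (fun A : E →L[ℝ] E => A v) (hinv (γ t))
      rw [h2] at h1
      have h3 : HasDerivWithinAt (fun t : ℝ => t • v) ((1 : ℝ) • v) (Icc 0 1) t :=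
        (hasDerivAt_id t).hasDerivWithinAt.smul_const v
      simpa using! h1.sub h3
    have := norm_image_sub_le_of_norm_deriv_le_segment_01' (C := 0) hd (fun t _ => by simp)
    have h4 : (h (γ 1) - (1 : ℝ) • v) - (h (γ 0) - (0 : ℝ) • v) = 0 := by
      simpa using this
    rw [h0] at h4
    have h5 : h (γ 1) = h x₀ + v + ((h (γ 1) - (1 : ℝ) • v) - (h x₀ - (0 : ℝ) • v)) := by
      simp only [one_smul, zero_smul, sub_zero]; abel
    rw [h5, h4, add_zero]
  · have := norm_image_sub_le_of_norm_deriv_le_segment_01' hγ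
      (fun t _ => hbd (γ t))
    rw [h0] at this
    simpa using this

/-- A global inverse function theorem: if the Jacobian of a `C¹` map `h` has a bounded Lipschitz
inverse `σ`, then `h` is bijective. Lifting segments from `h x₀` gives a continuous section of `h`,
and the range of a continuous section of a local homeomorphism is open and closed. -/
lemma bijective_of_jacobian_inverse {σ : E → E →L[ℝ] E} {h : E → E} {K C : ℝ≥0}
    (hσ : LipschitzWith K σ) (hC : ∀ x, ‖σ x‖ ≤ C) (hh : ContDiff ℝ 1 h)
    (hinv : ∀ x, (fderiv ℝ h x).comp (σ x) = ContinuousLinearMap.id ℝ E)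
    (hinv' : ∀ x, (σ x).comp (fderiv ℝ h x) = ContinuousLinearMap.id ℝ E) :
    Function.Bijective h := by
  have hdiff : Differentiable ℝ h := hh.differentiable (by simp)
  choose γ hγ0 hγ hγ1 _ using exists_lift_segment hσ hC hdiff hinv 0
  set Ψ : E → E := fun y => γ (y - h 0) 1 with hΨ
  have hsec : ∀ y, h (Ψ y) = y := fun y => by simp [hΨ, hγ1]
  have hΨc : Continuous Ψ := by
    suffices Continuous (fun v => γ v 1) by
      exact this.comp (continuous_id.sub continuous_const)
    rw [continuous_iff_continuousAt]
    intro v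
    have hlip := lipschitzWith_clm_apply hσ v
    have hcont : ∀ u, ContinuousOn (γ u) (Icc 0 1) :=
      fun u t ht => (hγ u t ht).continuousWithinAt
    have hder : ∀ u, ∀ t ∈ Ico (0 : ℝ) 1,
        HasDerivWithinAt (γ u) (σ (γ u t) u) (Ici t) t := fun u t ht =>
      (hγ u t ⟨ht.1, ht.2.le⟩).mono_of_mem_nhdsWithin
        (Filter.mem_of_superset (Icc_mem_nhdsGE ht.2) (Icc_subset_Icc_left ht.1))
    have hbound : ∀ u, dist (γ u 1) (γ v 1) ≤
        gronwallBound 0 (K * ‖v‖₊ : ℝ≥0) (C * ‖u - v‖ + 0) (1 - 0) := fun u =>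
      dist_le_of_approx_trajectories_ODE (v := fun _ x => σ x v) (fun _ => hlip)
        (hcont u) (hder u) (fun t _ => by
          rw [dist_eq_norm, ← map_sub]
          exact (ContinuousLinearMap.le_opNorm _ _).trans (by gcongr; exact hC _))
        (hcont v) (hder v) (fun t _ => by simp) (by simp [hγ0]) 1 (by simp)
    rw [ContinuousAt, tendsto_iff_dist_tendsto_zero]
    refine squeeze_zero (fun _ => dist_nonneg) hbound ?_
    have h1 : Continuous fun u => gronwallBound 0 (K * ‖v‖₊ : ℝ≥0) (C * ‖u - v‖ + 0) (1 - 0) :=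
      (gronwallBound_continuous_ε _ _ _).comp (by fun_prop)
    have h2 := h1.tendsto v
    simpa [gronwallBound_ε0_δ0] using h2
  have hloc : ∀ x, ∃ N ∈ nhds x, InjOn h N := by
    intro x
    let e : E ≃L[ℝ] E := ContinuousLinearEquiv.equivOfInverse (fderiv ℝ h x) (σ x)
      (fun y => by simpa using congrArg (fun A : E →L[ℝ] E => A y) (hinv' x))
      (fun y => by simpa using congrArg (fun A : E →L[ℝ] E => A y) (hinv x))
    have hst : HasStrictFDerivAt h (e : E →L[ℝ] E) x :=
      hh.contDiffAt.hasStrictFDerivAt (by simp)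
    refine ⟨(hst.toOpenPartialHomeomorph h).source,
      (hst.toOpenPartialHomeomorph h).open_source.mem_nhds
        hst.mem_toOpenPartialHomeomorph_source, ?_⟩
    simpa using (hst.toOpenPartialHomeomorph h).injOn
  have hclosed : IsClosed (range Ψ) := by
    have : range Ψ = {x | Ψ (h x) = x} := by
      ext x
      constructor
      · rintro ⟨y, rfl⟩; simp [hsec]
      · intro hx; exact ⟨h x, hx⟩
    rw [this]
    exact isClosed_eq (hΨc.comp hh.continuous) continuous_id
  have hopen : IsOpen (range Ψ) := by
    rw [isOpen_iff_mem_nhds]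
    rintro _ ⟨y, rfl⟩
    obtain ⟨N, hN, hinj⟩ := hloc (Ψ y)
    have hc : ContinuousAt (fun x => Ψ (h x)) (Ψ y) :=
      (hΨc.comp hh.continuous).continuousAt
    have h1 : ∀ᶠ x in nhds (Ψ y), Ψ (h x) ∈ N := hc (by simpa [hsec] using hN)
    filter_upwards [h1, hN] with x hx hx'
    exact ⟨h x, hinj hx hx' (hsec _)⟩
  have huniv : range Ψ = univ := IsClopen.eq_univ ⟨hclosed, hopen⟩ ⟨_, mem_range_self 0⟩
  refine ⟨fun x x' hxx => ?_, fun y => ⟨Ψ y, hsec y⟩⟩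
  obtain ⟨y, rfl⟩ : x ∈ range Ψ := huniv ▸ mem_univ x
  obtain ⟨y', rfl⟩ : x' ∈ range Ψ := huniv ▸ mem_univ x'
  rw [hsec, hsec] at hxx
  rw [hxx]

lemma lipschitzWith_invFun_of_jacobian_inverse {σ : E → E →L[ℝ] E} {h : E → E} {K C : ℝ≥0}
    (hσ : LipschitzWith K σ) (hC : ∀ x, ‖σ x‖ ≤ C) (hh : ContDiff ℝ 1 h)
    (hinv : ∀ x, (fderiv ℝ h x).comp (σ x) = ContinuousLinearMap.id ℝ E)
    (hinv' : ∀ x, (σ x).comp (fderiv ℝ h x) = ContinuousLinearMap.id ℝ E) :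
    LipschitzWith C (Function.invFun h) := by
  have hb := bijective_of_jacobian_inverse hσ hC hh hinv hinv'
  refine LipschitzWith.of_dist_le_mul fun y y' => ?_
  obtain ⟨γ, -, -, h1, h2⟩ := exists_lift_segment hσ hC (hh.differentiable (by simp)) hinv
    (Function.invFun h y') (y - y')
  rw [Function.rightInverse_invFun hb.2 y', add_sub_cancel] at h1
  rw [← h1, Function.leftInverse_invFun hb.1] at *
  simpa [dist_eq_norm, h1] using h2

end Hadamard

/-! ### The localised drift -/

variable {d : ℕ} {p : Params d}

lemma Params.Valid.exists_lipschitzWith_invFun (hp : p.Valid) :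
    Function.Bijective p.h ∧ ∃ C : ℝ≥0, LipschitzWith C (Function.invFun p.h) := by
  obtain ⟨-, -, hσ1, γ, -, C, hC⟩ := hp.coefficients
  obtain ⟨hh, -, hinv⟩ := hp.jacobian
  have hlip : LipschitzWith C.toNNReal p.σ :=
    lipschitzWith_of_nnnorm_fderiv_le (𝕜 := ℝ) (hσ1.differentiable (by simp)) fun x => by
      rw [← NNReal.coe_le_coe, coe_nnnorm]
      exact (hC x x).2.1.trans (Real.le_coe_toNNReal C)
  have hbd : ∀ x, ‖p.σ x‖ ≤ (C.toNNReal : ℝ) := fun x =>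
    (hC x x).1.trans (Real.le_coe_toNNReal C)
  exact ⟨bijective_of_jacobian_inverse hlip hbd hh (fun x => (hinv x).1) (fun x => (hinv x).2),
    _, lipschitzWith_invFun_of_jacobian_inverse hlip hbd hh
      (fun x => (hinv x).1) (fun x => (hinv x).2)⟩

lemma Params.Valid.exists_norm_driftLoc_sub_le (hp : p.Valid) :
    ∃ L : ℝ, ∀ z z', ‖p.driftLoc z - p.driftLoc z'‖ ≤ L * ‖z - z'‖ := by
  obtain ⟨-, C, hC⟩ := hp.exists_lipschitzWith_invFun
  obtain ⟨hh, hloc, -⟩ := hp.jacobian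
  have hϖ := hp.localization
  obtain ⟨C₁, hC₁⟩ := hϖ.jacobian_bound
  obtain ⟨L₁, hL₁⟩ := hϖ.jacobian_lipschitz
  obtain ⟨C₂, hC₂⟩ := hϖ.drift_bound
  obtain ⟨L₂, hL₂⟩ := hϖ.drift_lipschitz
  have hcomp : IsCompact (Metric.closedBall (0 : Vec d) (p.a + 1)) := isCompact_closedBall _ _
  obtain ⟨L₀, hL₀⟩ := (hloc.locallyLipschitzOn (s := Metric.closedBall 0 (p.a + 1))
    ).exists_lipschitzOnWith_of_compact hcomp
  obtain ⟨C₀, hC₀⟩ := hcomp.exists_bound_of_continuousOn hloc.continuous.continuousOn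
  have hmem : ∀ x, p.ϖ x ∈ Metric.closedBall (0 : Vec d) (p.a + 1) := fun x => by
    simpa using hϖ.bound x
  have hC₁0 : 0 ≤ C₁ := (norm_nonneg _).trans (hC₁ 0)
  have hC₂0 : 0 ≤ C₂ := (norm_nonneg _).trans (hC₂ 0)
  have hC₀0 : 0 ≤ C₀ := (norm_nonneg _).trans (hC₀ _ (hmem 0))
  have hϖl : LipschitzWith C₁.toNNReal p.ϖ :=
    lipschitzWith_of_nnnorm_fderiv_le (𝕜 := ℝ) (hϖ.contDiff.differentiable (by simp)) fun x => by
      rw [← NNReal.coe_le_coe, coe_nnnorm]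
      exact (hC₁ x).trans (Real.le_coe_toNNReal _)
  have hchain : ∀ x, fderiv ℝ p.hLoc x = (fderiv ℝ p.h (p.ϖ x)).comp (fderiv ℝ p.ϖ x) := fun x =>
    fderiv_comp x (hh.differentiable (by simp) _) (hϖ.contDiff.differentiable (by simp) x)
  have key : ∀ x x', ‖fderiv ℝ p.hLoc x (p.bLoc x) - fderiv ℝ p.hLoc x' (p.bLoc x')‖ ≤
      (L₀ * C₁ * C₁ * C₂ + C₀ * L₁ * C₂ + C₀ * C₁ * L₂) * ‖x - x'‖ := by
    intro x x'
    rw [hchain, hchain]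
    have e : (fderiv ℝ p.h (p.ϖ x)).comp (fderiv ℝ p.ϖ x) (p.bLoc x) -
        (fderiv ℝ p.h (p.ϖ x')).comp (fderiv ℝ p.ϖ x') (p.bLoc x') =
        (fderiv ℝ p.h (p.ϖ x) - fderiv ℝ p.h (p.ϖ x')) (fderiv ℝ p.ϖ x (p.bLoc x)) +
        fderiv ℝ p.h (p.ϖ x') ((fderiv ℝ p.ϖ x - fderiv ℝ p.ϖ x') (p.bLoc x)) +
        fderiv ℝ p.h (p.ϖ x') (fderiv ℝ p.ϖ x' (p.bLoc x - p.bLoc x')) := by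
      simp
    have b1 : ‖fderiv ℝ p.h (p.ϖ x) - fderiv ℝ p.h (p.ϖ x')‖ ≤ L₀ * (C₁ * ‖x - x'‖) := by
      have h1 := hL₀.dist_le_mul _ (hmem x) _ (hmem x')
      have h2 := hϖl.dist_le_mul x x'
      rw [Real.coe_toNNReal _ hC₁0] at h2
      rw [← dist_eq_norm, ← dist_eq_norm]
      exact h1.trans (by gcongr)
    have b2 : ‖fderiv ℝ p.ϖ x - fderiv ℝ p.ϖ x'‖ ≤ L₁ * ‖x - x'‖ := by
      simpa [dist_eq_norm] using hL₁.dist_le_mul x x'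
    have b3 : ‖p.bLoc x - p.bLoc x'‖ ≤ L₂ * ‖x - x'‖ := by
      simpa [dist_eq_norm] using hL₂.dist_le_mul x x'
    rw [e]
    calc _ ≤ ‖fderiv ℝ p.h (p.ϖ x) - fderiv ℝ p.h (p.ϖ x')‖ * (‖fderiv ℝ p.ϖ x‖ * ‖p.bLoc x‖) +
          ‖fderiv ℝ p.h (p.ϖ x')‖ * (‖fderiv ℝ p.ϖ x - fderiv ℝ p.ϖ x'‖ * ‖p.bLoc x‖) +
          ‖fderiv ℝ p.h (p.ϖ x')‖ * (‖fderiv ℝ p.ϖ x'‖ * ‖p.bLoc x - p.bLoc x'‖) := by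
          refine (norm_add₃_le).trans ?_
          gcongr <;> exact (ContinuousLinearMap.le_opNorm _ _).trans (by
            gcongr; exact ContinuousLinearMap.le_opNorm _ _)
      _ ≤ (L₀ * (C₁ * ‖x - x'‖)) * (C₁ * C₂) + C₀ * ((L₁ * ‖x - x'‖) * C₂) +
          C₀ * (C₁ * (L₂ * ‖x - x'‖)) := by
          have := hC₁ x; have := hC₁ x'; have := hC₂ x; have := hC₀ _ (hmem x')
          gcongr
      _ = _ := by ring
  refine ⟨(L₀ * C₁ * C₁ * C₂ + C₀ * L₁ * C₂ + C₀ * C₁ * L₂) * C, fun z z' => ?_⟩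
  refine (key _ _).trans ?_
  rw [mul_assoc (_ + _ + _)]
  exact mul_le_mul_of_nonneg_left (by simpa [dist_eq_norm] using hC.dist_le_mul z z')
    (by positivity)

/-- The supremum defining `κ₁` is finite, so that `κ₁` is a Lipschitz constant of the drift. -/
lemma Params.Valid.norm_driftLoc_sub_le (hp : p.Valid) (z z' : Vec d) :
    ‖p.driftLoc z - p.driftLoc z'‖ ≤ p.κ₁ * ‖z - z'‖ := by
  obtain ⟨L, hL⟩ := hp.exists_norm_driftLoc_sub_le
  rcases eq_or_ne z z' with rfl | hne
  · simp
  have hpos : 0 < ‖z - z'‖ := norm_pos_iff.2 (sub_ne_zero.2 hne)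
  rw [← div_le_iff₀ hpos]
  refine le_ciSup (f := fun z : Vec d × Vec d => ‖p.driftLoc z.2 - p.driftLoc z.1‖ / ‖z.2 - z.1‖)
    ⟨|L|, ?_⟩ (z', z)
  rintro _ ⟨w, rfl⟩
  refine div_le_of_le_mul₀ (norm_nonneg _) (abs_nonneg _) ((hL _ _).trans ?_)
  gcongr
  exact le_abs_self L

lemma Params.κ₁_nonneg : 0 ≤ p.κ₁ := Real.iSup_nonneg fun _ => by positivity

lemma Params.κ₂_nonneg : 0 ≤ p.κ₂ := by unfold Params.κ₂; positivity

lemma Params.Valid.continuous_driftLoc (hp : p.Valid) : Continuous p.driftLoc :=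
  (LipschitzWith.of_dist_le_mul (K := p.κ₁.toNNReal) fun z z' => by
    rw [Real.coe_toNNReal _ Params.κ₁_nonneg, dist_eq_norm, dist_eq_norm]
    exact hp.norm_driftLoc_sub_le z z').continuous

/-- The supremum `sup_{x, y ∈ B(0,K)} |h(y) - h(x)|` of the distance between the two companions at
the beginning of Step 1. -/
noncomputable def Params.spread (p : Params d) : ℝ :=
  sSup {r | ∃ x y : Vec d, ‖x‖ ≤ p.K ∧ ‖y‖ ≤ p.K ∧ r = ‖p.h y - p.h x‖}

lemma Params.Valid.norm_hLoc_sub_le (hp : p.Valid) {x y : Vec d} (hx : ‖x‖ ≤ p.K)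
    (hy : ‖y‖ ≤ p.K) : ‖p.hLoc y - p.hLoc x‖ ≤ p.spread := by
  have h1 : p.hLoc x = p.h x := by
    rw [Params.hLoc, hp.localization.eq_id x (hx.trans hp.ha)]
  have h2 : p.hLoc y = p.h y := by
    rw [Params.hLoc, hp.localization.eq_id y (hy.trans hp.ha)]
  rw [h1, h2]
  obtain ⟨C, hC⟩ := (isCompact_closedBall (0 : Vec d) p.K).exists_bound_of_continuousOn
    hp.jacobian.1.continuous.continuousOn
  refine le_csSup ⟨C + C, ?_⟩ ⟨x, y, hx, hy, rfl⟩
  rintro _ ⟨x, y, hx, hy, rfl⟩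
  exact (norm_sub_le _ _).trans
    (add_le_add (hC _ (by simpa using hy)) (hC _ (by simpa using hx)))

lemma Params.Valid.spread_nonneg (hp : p.Valid) : 0 ≤ p.spread := by
  have := hp.norm_hLoc_sub_le (x := 0) (y := 0) (by simpa using hp.hK.le) (by simpa using hp.hK.le)
  simpa using this

/-! ### The feedback drift along the difference of the companions -/

section Feedback

variable {E : Type*} [NormedAddCommGroup E] [NormedSpace ℝ E]

lemma norm_inv_sqrt_smul (u : E) : ‖(Real.sqrt ‖u‖)⁻¹ • u‖ = Real.sqrt ‖u‖ := by
  rw [norm_smul, norm_inv, Real.norm_of_nonneg (Real.sqrt_nonneg _), inv_mul_eq_div,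
    Real.div_sqrt]

lemma continuous_inv_sqrt_smul : Continuous fun u : E => (Real.sqrt ‖u‖)⁻¹ • u := by
  rw [continuous_iff_continuousAt]
  intro u
  rcases eq_or_ne u 0 with rfl | hu
  · rw [ContinuousAt, norm_zero, Real.sqrt_zero, inv_zero, zero_smul,
      tendsto_zero_iff_norm_tendsto_zero]
    simp only [norm_inv_sqrt_smul]
    have : Continuous fun u : E => Real.sqrt ‖u‖ := by fun_prop
    simpa using this.tendsto 0
  · have : Real.sqrt ‖u‖ ≠ 0 := (Real.sqrt_pos.2 (norm_pos_iff.2 hu)).ne'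
    exact ContinuousAt.smul (ContinuousAt.inv₀ (by fun_prop) this) continuousAt_id

/-- `u ↦ u / √|u|` is Lipschitz with constant `2 / √|u|` inside the ball of radius `|u|`. -/
lemma norm_inv_sqrt_smul_sub_le {u v : E} (hvu : ‖v‖ ≤ ‖u‖) :
    ‖(Real.sqrt ‖u‖)⁻¹ • u - (Real.sqrt ‖v‖)⁻¹ • v‖ * Real.sqrt ‖u‖ ≤ 2 * ‖u - v‖ := by
  rcases eq_or_ne v 0 with rfl | hv
  · simp only [smul_zero, sub_zero, norm_inv_sqrt_smul, Real.mul_self_sqrt (norm_nonneg u)]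
    linarith [norm_nonneg u]
  have hv0 : 0 < ‖v‖ := norm_pos_iff.2 hv
  have hu0 : 0 < ‖u‖ := hv0.trans_le hvu
  set b := Real.sqrt ‖v‖ with hb
  set c := Real.sqrt ‖u‖ with hc
  have hb0 : 0 < b := Real.sqrt_pos.2 hv0
  have hc0 : 0 < c := Real.sqrt_pos.2 hu0
  have hbc : b ≤ c := Real.sqrt_le_sqrt hvu
  have hbb : b * b = ‖v‖ := Real.mul_self_sqrt hv0.le
  have hcc : c * c = ‖u‖ := Real.mul_self_sqrt hu0.le
  have e : c⁻¹ • u - b⁻¹ • v = c⁻¹ • (u - v) - (b⁻¹ - c⁻¹) • v := by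
    rw [smul_sub, sub_smul]; abel
  have h1 : ‖c⁻¹ • u - b⁻¹ • v‖ ≤ c⁻¹ * ‖u - v‖ + (b⁻¹ - c⁻¹) * ‖v‖ := by
    rw [e]
    refine (norm_sub_le _ _).trans ?_
    rw [norm_smul, norm_smul, Real.norm_of_nonneg (inv_nonneg.2 hc0.le),
      Real.norm_of_nonneg (sub_nonneg.2 (inv_anti₀ hb0 hbc))]
  have h2 : (c⁻¹ * ‖u - v‖ + (b⁻¹ - c⁻¹) * ‖v‖) * c = ‖u - v‖ + b * (c - b) := by
    rw [← hbb]; field_simp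
  have h3 : ‖u‖ - ‖v‖ ≤ ‖u - v‖ := norm_sub_norm_le u v
  calc _ ≤ (c⁻¹ * ‖u - v‖ + (b⁻¹ - c⁻¹) * ‖v‖) * c := by gcongr
    _ = ‖u - v‖ + b * (c - b) := h2
    _ ≤ 2 * ‖u - v‖ := by nlinarith

end Feedback

lemma Params.continuous_feedback : Continuous p.feedback := by
  have := continuous_inv_sqrt_smul (E := Vec d)
  unfold Params.feedback
  exact ((continuous_id.const_smul p.κ₁).neg).sub (this.const_smul p.κ₂)

lemma Params.norm_feedback_le (u : Vec d) :
    ‖p.feedback u‖ ≤ p.κ₁ * ‖u‖ + p.κ₂ * Real.sqrt ‖u‖ := by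
  unfold Params.feedback
  refine (norm_sub_le _ _).trans ?_
  rw [norm_neg, norm_smul, norm_smul, norm_inv_sqrt_smul, Real.norm_of_nonneg p.κ₁_nonneg,
    Real.norm_of_nonneg p.κ₂_nonneg]

lemma Params.inner_feedback_le (u : Vec d) : inner ℝ u (p.feedback u) ≤ -(p.κ₁ * ‖u‖ ^ 2) := by
  unfold Params.feedback
  rw [inner_sub_right, inner_neg_right, inner_smul_right, inner_smul_right, inner_smul_right,
    real_inner_self_eq_norm_sq]
  have : 0 ≤ p.κ₂ * ((Real.sqrt ‖u‖)⁻¹ * ‖u‖ ^ 2) :=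
    mul_nonneg p.κ₂_nonneg (by positivity)
  linarith

/-! ### The drift of Step 1 -/

section Companions

variable {y ρ : ℝ → Vec d} {ρ₀ : Vec d}

/-- The velocity of the difference `ρ` of the two companions. -/
noncomputable def Params.companionVelocity (p : Params d) (y ρ : ℝ → Vec d) (s : ℝ) : Vec d :=
  p.driftLoc (y s + ρ s) - p.driftLoc (y s) + p.feedback (ρ s)

lemma Params.Valid.continuousOn_companionVelocity (hp : p.Valid) (hy : ContinuousOn y (Icc 0 1))
    (hρ : ContinuousOn ρ (Icc 0 1)) : ContinuousOn (p.companionVelocity y ρ) (Icc 0 1) :=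
  ((hp.continuous_driftLoc.comp_continuousOn (hy.add hρ)).sub
    (hp.continuous_driftLoc.comp_continuousOn hy)).add
    (Params.continuous_feedback.comp_continuousOn hρ)

lemma Params.Valid.norm_companionVelocity_le (hp : p.Valid) (s : ℝ) :
    ‖p.companionVelocity y ρ s‖ ≤ 2 * p.κ₁ * ‖ρ s‖ + p.κ₂ * Real.sqrt ‖ρ s‖ := by
  have h1 := hp.norm_driftLoc_sub_le (y s + ρ s) (y s)
  rw [add_sub_cancel_left] at h1
  have h2 := p.norm_feedback_le (ρ s)
  have h3 := norm_add_le (p.driftLoc (y s + ρ s) - p.driftLoc (y s)) (p.feedback (ρ s))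
  unfold Params.companionVelocity
  linarith

/-- The term `-κ₁ ρ` of the feedback compensates the Lipschitz drift, so that `|ρ|` decreases. -/
lemma Params.Valid.antitoneOn_norm_companion (hp : p.Valid) (hy : ContinuousOn y (Icc 0 1))
    (hρ : ContinuousOn ρ (Icc 0 1))
    (hρ' : ∀ t ∈ Icc (0 : ℝ) 1, ρ t = ρ₀ + ∫ s in (0 : ℝ)..t, p.companionVelocity y ρ s) :
    AntitoneOn (fun t => ‖ρ t‖) (Icc 0 1) := by
  have hv := hp.continuousOn_companionVelocity hy hρ
  have hder : ∀ t ∈ Ioo (0 : ℝ) 1, HasDerivAt ρ (p.companionVelocity y ρ t) t := by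
    intro t ht
    have hvt : ContinuousAt (p.companionVelocity y ρ) t :=
      hv.continuousAt (Icc_mem_nhds ht.1 ht.2)
    have hint : IntervalIntegrable (p.companionVelocity y ρ) volume 0 t :=
      (hv.mono (by rw [uIcc_of_le ht.1.le]; exact Icc_subset_Icc_right ht.2.le)).intervalIntegrable
    have h1 := (intervalIntegral.integral_hasDerivAt_right hint
      ((hv.mono Ioo_subset_Icc_self).stronglyMeasurableAtFilter isOpen_Ioo t ht) hvt).const_add ρ₀
    refine h1.congr_of_eventuallyEq ?_
    filter_upwards [Icc_mem_nhds ht.1 ht.2] with r hr using hρ' r hr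
  have hsq : AntitoneOn (fun t => ‖ρ t‖ ^ 2) (Icc 0 1) := by
    have hd : ∀ t ∈ Ioo (0 : ℝ) 1, HasDerivAt (fun t => ‖ρ t‖ ^ 2)
        (2 * inner ℝ (ρ t) (p.companionVelocity y ρ t)) t :=
      fun t ht => (hder t ht).norm_sq
    refine antitoneOn_of_deriv_nonpos (convex_Icc 0 1) (hρ.norm.pow 2) ?_ ?_
    · rw [interior_Icc]
      exact fun t ht => (hd t ht).differentiableAt.differentiableWithinAt
    · rw [interior_Icc]
      intro t ht
      rw [(hd t ht).deriv, Params.companionVelocity, inner_add_right]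
      have h1 := p.inner_feedback_le (ρ t)
      have h2 := hp.norm_driftLoc_sub_le (y t + ρ t) (y t)
      rw [add_sub_cancel_left] at h2
      have h3 := real_inner_le_norm (ρ t) (p.driftLoc (y t + ρ t) - p.driftLoc (y t))
      nlinarith [norm_nonneg (ρ t)]
  intro s hs t ht hst
  exact le_of_sq_le_sq (hsq hs ht hst) (norm_nonneg _)

/-- Although the feedback is only `1/2`-Hölder at the origin, it is Lipschitz in time along `ρ`:
its slope near `ρ` is of order `|ρ|^(-1/2)`, and the velocity of `ρ` is of order `|ρ|^(1/2)`. -/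
lemma Params.Valid.norm_feedback_companion_sub_le (hp : p.Valid) (hy : ContinuousOn y (Icc 0 1))
    (hρ : ContinuousOn ρ (Icc 0 1))
    (hρ' : ∀ t ∈ Icc (0 : ℝ) 1, ρ t = ρ₀ + ∫ s in (0 : ℝ)..t, p.companionVelocity y ρ s)
    {R : ℝ} (hR : ‖ρ₀‖ ≤ R) {s t : ℝ} (hs : 0 ≤ s) (hst : s ≤ t) (ht : t ≤ 1) :
    ‖p.feedback (ρ t) - p.feedback (ρ s)‖ ≤
      (2 * p.κ₁ * Real.sqrt R + p.κ₂) * (p.κ₁ * Real.sqrt R + 2 * p.κ₂) * (t - s) := by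
  have hanti := hp.antitoneOn_norm_companion hy hρ hρ'
  have hv := hp.continuousOn_companionVelocity hy hρ
  have hκ₁ := p.κ₁_nonneg
  have hκ₂ := p.κ₂_nonneg
  have hs' : s ∈ Icc (0 : ℝ) 1 := ⟨hs, hst.trans ht⟩
  have ht' : t ∈ Icc (0 : ℝ) 1 := ⟨hs.trans hst, ht⟩
  have hρs : ‖ρ s‖ ≤ R := by
    have h0 := hρ' 0 (by simp)
    simp only [intervalIntegral.integral_same, add_zero] at h0
    rw [← h0] at hR
    exact (hanti (by simp) hs' hs).trans hR
  set D := 2 * p.κ₁ * Real.sqrt R + p.κ₂ with hD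
  have hD0 : 0 ≤ D := by positivity
  set c := Real.sqrt ‖ρ s‖ with hc
  have hcR : c ≤ Real.sqrt R := Real.sqrt_le_sqrt hρs
  have hcc : c * c = ‖ρ s‖ := Real.mul_self_sqrt (norm_nonneg _)
  have hc0 : 0 ≤ c := Real.sqrt_nonneg _
  have hdiff : ‖ρ t - ρ s‖ ≤ D * c * (t - s) := by
    have hint : ∀ r ∈ Icc (0 : ℝ) 1, IntervalIntegrable (p.companionVelocity y ρ) volume 0 r :=
      fun r hr => (hv.mono (by
        rw [uIcc_of_le hr.1]; exact Icc_subset_Icc_right hr.2)).intervalIntegrable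
    have e : ρ t - ρ s = ∫ r in s..t, p.companionVelocity y ρ r := by
      rw [hρ' t ht', hρ' s hs', add_sub_add_left_eq_sub,
        intervalIntegral.integral_interval_sub_left (hint t ht') (hint s hs')]
    rw [e, ← abs_of_nonneg (sub_nonneg.2 hst)]
    refine intervalIntegral.norm_integral_le_of_norm_le_const fun r hr => ?_
    rw [uIoc_of_le hst] at hr
    have hr1 : ‖ρ r‖ ≤ ‖ρ s‖ := hanti hs' ⟨hs.trans hr.1.le, hr.2.trans ht⟩ hr.1.le
    have hr2 : Real.sqrt ‖ρ r‖ ≤ c := Real.sqrt_le_sqrt hr1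
    calc ‖p.companionVelocity y ρ r‖ ≤ 2 * p.κ₁ * ‖ρ r‖ + p.κ₂ * Real.sqrt ‖ρ r‖ :=
          hp.norm_companionVelocity_le r
      _ ≤ 2 * p.κ₁ * (c * c) + p.κ₂ * c := by rw [hcc]; gcongr
      _ ≤ 2 * p.κ₁ * (Real.sqrt R * c) + p.κ₂ * c := by gcongr
      _ = D * c := by rw [hD]; ring
  have hφ : ‖(Real.sqrt ‖ρ t‖)⁻¹ • ρ t - (Real.sqrt ‖ρ s‖)⁻¹ • ρ s‖ ≤ 2 * D * (t - s) := by
    have hts : ‖ρ t‖ ≤ ‖ρ s‖ := hanti hs' ht' hst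
    have h1 := norm_inv_sqrt_smul_sub_le hts
    rw [norm_sub_rev, norm_sub_rev (ρ s)] at h1
    rcases hc0.eq_or_lt with h0 | hpos
    · have hz : ‖ρ s‖ = 0 := by rw [← hcc, ← h0, zero_mul]
      have hz' : ‖ρ t‖ = 0 := le_antisymm (hts.trans hz.le) (norm_nonneg _)
      rw [norm_eq_zero] at hz hz'
      rw [hz, hz', sub_self, norm_zero]
      have := sub_nonneg.2 hst
      positivity
    · refine le_of_mul_le_mul_right (h1.trans ?_) hpos
      linarith
  have e : p.feedback (ρ t) - p.feedback (ρ s) = -(p.κ₁ • (ρ t - ρ s)) -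
      p.κ₂ • ((Real.sqrt ‖ρ t‖)⁻¹ • ρ t - (Real.sqrt ‖ρ s‖)⁻¹ • ρ s) := by
    unfold Params.feedback
    simp only [smul_sub]
    abel
  rw [e]
  refine (norm_sub_le _ _).trans ?_
  rw [norm_neg, norm_smul, norm_smul, Real.norm_of_nonneg hκ₁, Real.norm_of_nonneg hκ₂]
  have hts := sub_nonneg.2 hst
  calc p.κ₁ * ‖ρ t - ρ s‖ +
        p.κ₂ * ‖(Real.sqrt ‖ρ t‖)⁻¹ • ρ t - (Real.sqrt ‖ρ s‖)⁻¹ • ρ s‖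
      ≤ p.κ₁ * (D * Real.sqrt R * (t - s)) + p.κ₂ * (2 * D * (t - s)) := by
        gcongr
        exact hdiff.trans (by gcongr)
    _ = _ := by ring

end Companions

/-- The derivative of the fractional integral of a Lipschitz function (where it does not exist,
`deriv` is zero and the bound is trivial). -/
lemma norm_deriv_fractional_integral_le {E : Type*} [NormedAddCommGroup E] [NormedSpace ℝ E]
    {F : ℝ → E} {a M Λ : ℝ} (ha : 0 ≤ a) (ha1 : a < 1) (hF : ContinuousOn F (Icc 0 1))
    (hM : ∀ t ∈ Icc (0 : ℝ) 1, ‖F t‖ ≤ M)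
    (hΛ : ∀ s t : ℝ, 0 ≤ s → s ≤ t → t ≤ 1 → ‖F t - F s‖ ≤ Λ * (t - s)) {t : ℝ}
    (ht : t ∈ Ioo (0 : ℝ) 1) :
    ‖deriv (fun r => ∫ s in (0 : ℝ)..r, (r - s) ^ (-a) • F s) t‖ ≤
      M * t ^ (-a) + Λ / (1 - a) := by
  have hM0 : 0 ≤ M := (norm_nonneg _).trans (hM 0 (by simp))
  have hΛ0 : 0 ≤ Λ := by
    have := (norm_nonneg _).trans (hΛ 0 1 le_rfl zero_le_one le_rfl); simpa using this
  set J : ℝ → E := fun r => ∫ s in (0 : ℝ)..r, (r - s) ^ (-a) • F s with hJ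
  by_cases hd : DifferentiableAt ℝ J t
  swap
  · rw [deriv_zero_of_not_differentiableAt hd, norm_zero]
    have := ht.1.le
    have : 0 < 1 - a := by linarith
    positivity
  have hJ' : ∀ r, J r = ∫ u in (0 : ℝ)..r, u ^ (-a) • F (r - u) := fun r => by
    have := intervalIntegral.integral_comp_sub_left (a := 0) (b := r)
      (fun u => u ^ (-a) • F (r - u)) r
    simpa [hJ] using this
  have hpow : ∀ u v : ℝ, IntervalIntegrable (fun u : ℝ => u ^ (-a)) volume u v :=
    fun u v => intervalIntegral.intervalIntegrable_rpow' (by linarith)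
  have hint : ∀ r ∈ Ioo (0 : ℝ) 1, ∀ u v : ℝ, 0 ≤ u → u ≤ v → v ≤ r →
      IntervalIntegrable (fun u => u ^ (-a) • F (r - u)) volume u v := by
    intro r hr u v hu huv hv
    refine (hpow u v).smul_continuousOn (hF.comp (by fun_prop) fun x hx => ?_)
    rw [uIcc_of_le huv] at hx
    constructor <;> linarith [hx.1, hx.2, hr.1, hr.2]
  have key : ∀ ε ∈ Ioo (0 : ℝ) (1 - t), ‖ε⁻¹ • (J (t + ε) - J t)‖ ≤
      M * t ^ (-a) + Λ / (1 - a) := by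
    intro ε hε
    have hr : t + ε ∈ Ioo (0 : ℝ) 1 := ⟨by linarith [ht.1, hε.1], by linarith [hε.2]⟩
    have hts : t ≤ t + ε := by linarith [hε.1]
    have e : J (t + ε) - J t = (∫ u in t..(t + ε), u ^ (-a) • F (t + ε - u)) +
        ∫ u in (0 : ℝ)..t, u ^ (-a) • (F (t + ε - u) - F (t - u)) := by
      rw [hJ', hJ', ← intervalIntegral.integral_add_adjacent_intervals
        (hint _ hr 0 t le_rfl ht.1.le hts) (hint _ hr t _ ht.1.le hts le_rfl)]
      simp only [smul_sub]
      rw [intervalIntegral.integral_sub (hint _ hr 0 t le_rfl ht.1.le hts)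
        (hint _ ht 0 t le_rfl ht.1.le le_rfl)]
      abel
    have b1 : ‖∫ u in t..(t + ε), u ^ (-a) • F (t + ε - u)‖ ≤ t ^ (-a) * M * ε := by
      have := intervalIntegral.norm_integral_le_of_norm_le_const
        (f := fun u => u ^ (-a) • F (t + ε - u)) (a := t) (b := t + ε) (C := t ^ (-a) * M) ?_
      · rwa [add_sub_cancel_left, abs_of_pos hε.1] at this
      · intro u hu
        rw [uIoc_of_le hts] at hu
        have hu0 : 0 < u := ht.1.trans hu.1
        rw [norm_smul, Real.norm_of_nonneg (by positivity)]
        have := hM (t + ε - u) ⟨by linarith [hu.2], by linarith [hu.1, hε.2, ht.1]⟩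
        have h2 : u ^ (-a) ≤ t ^ (-a) := Real.rpow_le_rpow_of_nonpos ht.1 hu.1.le (by linarith)
        exact mul_le_mul h2 this (norm_nonneg _) (Real.rpow_nonneg ht.1.le _)
    have b2 : ‖∫ u in (0 : ℝ)..t, u ^ (-a) • (F (t + ε - u) - F (t - u))‖ ≤
        Λ / (1 - a) * ε := by
      have h1 : ‖∫ u in (0 : ℝ)..t, u ^ (-a) • (F (t + ε - u) - F (t - u))‖ ≤
          ∫ u in (0 : ℝ)..t, u ^ (-a) * (Λ * ε) := by
        refine intervalIntegral.norm_integral_le_of_norm_le ht.1.le ?_ ((hpow 0 t).mul_const _)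
        refine Filter.Eventually.of_forall fun u hu => ?_
        rw [norm_smul, Real.norm_of_nonneg (Real.rpow_nonneg hu.1.le _)]
        have := hΛ (t - u) (t + ε - u) (by linarith [hu.2]) (by linarith)
          (by linarith [hu.1, hε.2])
        rw [show t + ε - u - (t - u) = ε by ring] at this
        have hu0 := hu.1.le
        gcongr
      refine h1.trans ?_
      rw [intervalIntegral.integral_mul_const, integral_rpow (Or.inl (by linarith)),
        Real.zero_rpow (by linarith), sub_zero]
      have h2 : t ^ (-a + 1) ≤ 1 := Real.rpow_le_one ht.1.le ht.2.le (by linarith)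
      have h3 : 0 < -a + 1 := by linarith
      have hε0 := hε.1.le
      calc t ^ (-a + 1) / (-a + 1) * (Λ * ε) ≤ 1 / (-a + 1) * (Λ * ε) := by gcongr
        _ = Λ / (1 - a) * ε := by rw [show 1 - a = -a + 1 by ring]; ring
    rw [norm_smul, norm_inv, Real.norm_of_nonneg hε.1.le, inv_mul_le_iff₀ hε.1, e]
    refine (norm_add_le _ _).trans ((add_le_add b1 b2).trans (le_of_eq ?_))
    ring
  have hlim := (hd.hasDerivAt.tendsto_slope_zero_right).norm
  refine le_of_tendsto hlim ?_
  filter_upwards [Ioo_mem_nhdsGT (show (0 : ℝ) < 1 - t by linarith [ht.2])] with ε hε using key ε hε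

/-- The Cauchy-Schwarz inequality on an interval, without measurability assumption. -/
lemma lintegral_enorm_le_of_lintegral_sq_le {E : Type*} [NormedAddCommGroup E] {f : ℝ → E}
    {a b B : ℝ} (hab : a ≤ b) (hB : 0 < B)
    (hf : ∫⁻ t in Ioc a b, ‖f t‖ₑ ^ 2 ≤ ENNReal.ofReal (B ^ 2)) :
    ∫⁻ t in Ioc a b, ‖f t‖ₑ ≤ ENNReal.ofReal (Real.sqrt (b - a) * B) := by
  rcases hab.eq_or_lt with rfl | hab
  · simp
  set c := Real.sqrt (b - a) with hc
  have hc0 : 0 < c := Real.sqrt_pos.2 (sub_pos.2 hab)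
  have hcc : c * c = b - a := Real.mul_self_sqrt (sub_pos.2 hab).le
  have hpt : ∀ t, ‖f t‖ₑ ≤ ENNReal.ofReal (B / (2 * c)) +
      ENNReal.ofReal (c / (2 * B)) * ‖f t‖ₑ ^ 2 := by
    intro t
    rw [← ofReal_norm, ← ENNReal.ofReal_pow (norm_nonneg _),
      ← ENNReal.ofReal_mul (by positivity), ← ENNReal.ofReal_add (by positivity) (by positivity)]
    refine ENNReal.ofReal_le_ofReal ?_
    have : B / (2 * c) + c / (2 * B) * ‖f t‖ ^ 2 - ‖f t‖ =
        (B - c * ‖f t‖) ^ 2 / (2 * c * B) := by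
      field_simp; ring
    have h2 : 0 ≤ (B - c * ‖f t‖) ^ 2 / (2 * c * B) := by positivity
    linarith
  calc ∫⁻ t in Ioc a b, ‖f t‖ₑ
      ≤ ∫⁻ t in Ioc a b, (ENNReal.ofReal (B / (2 * c)) +
        ENNReal.ofReal (c / (2 * B)) * ‖f t‖ₑ ^ 2) := lintegral_mono hpt
    _ = ENNReal.ofReal (B / (2 * c)) * ENNReal.ofReal (b - a) +
        ENNReal.ofReal (c / (2 * B)) * ∫⁻ t in Ioc a b, ‖f t‖ₑ ^ 2 := by
        rw [lintegral_add_left measurable_const, lintegral_const_mul' _ _ ENNReal.ofReal_ne_top,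
          setLIntegral_const, Real.volume_Ioc]
    _ ≤ ENNReal.ofReal (B / (2 * c)) * ENNReal.ofReal (b - a) +
        ENNReal.ofReal (c / (2 * B)) * ENNReal.ofReal (B ^ 2) := by gcongr
    _ = ENNReal.ofReal (c * B) := by
        rw [← ENNReal.ofReal_mul (by positivity), ← ENNReal.ofReal_mul (by positivity),
          ← ENNReal.ofReal_add (mul_nonneg (by positivity) (by linarith)) (by positivity), ← hcc]
        congr 1; field_simp; ring

/-- The cost condition bounds `R_T g` in `L¹(0, L)`. -/
lemma MemoryCond.lintegral_memOp_le {H α : ℝ} {g : ℝ → Vec d} (hα : 0 ≤ α)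
    (hg : MemoryCond H α g) {T L : ℝ} (hT : 0 ≤ T) (hL : 0 ≤ L) :
    ∫⁻ t in Ioc 0 L, ‖memOp H T g t‖ₑ ≤ ENNReal.ofReal (Real.sqrt L) := by
  have h1 := (le_iSup (fun T : ℝ≥0 => ∫⁻ t in Ioi (0 : ℝ),
    ENNReal.ofReal ((1 + t) ^ (2 * α)) * ‖memOp H (T : ℝ) g t‖ₑ ^ 2) ⟨T, hT⟩).trans hg.2
  have h2 : ∫⁻ t in Ioc 0 L, ‖memOp H T g t‖ₑ ^ 2 ≤ ENNReal.ofReal (1 ^ 2) := by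
    rw [one_pow, ENNReal.ofReal_one]
    refine le_trans ?_ h1
    refine (setLIntegral_mono' measurableSet_Ioc fun t ht => ?_).trans
      (lintegral_mono_set Ioc_subset_Ioi_self)
    refine le_mul_of_one_le_left' ?_
    rw [← ENNReal.ofReal_one]
    exact ENNReal.ofReal_le_ofReal (Real.one_le_rpow (by linarith [ht.1]) (by linarith))
  simpa using lintegral_enorm_le_of_lintegral_sq_le hL one_pos h2

lemma setLIntegral_Ioc_comp_add_right (f : ℝ → ℝ≥0∞) (a b c : ℝ) :
    ∫⁻ t in Ioc a b, f (t + c) = ∫⁻ t in Ioc (a + c) (b + c), f t := by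
  have := (measurePreserving_add_right volume c).setLIntegral_comp_preimage_emb
    (MeasurableEquiv.addRight c).measurableEmbedding f (Ioc (a + c) (b + c))
  simpa using this

lemma setLIntegral_Iic_comp_add_right (f : ℝ → ℝ≥0∞) (b c : ℝ) :
    ∫⁻ t in Iic b, f (t + c) = ∫⁻ t in Iic (b + c), f t := by
  have := (measurePreserving_add_right volume c).setLIntegral_comp_preimage_emb
    (MeasurableEquiv.addRight c).measurableEmbedding f (Iic (b + c))
  simpa using this

/-- A bound of the drift of Step 1 in `L¹`, in terms of the parameters only. -/
noncomputable def Params.stepOneBound (p : Params d) : ℝ :=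
  |p.abelConst| + |p.abelConst / (alphaH p.H * (p.H - 1 / 2))| *
    ((p.κ₁ * p.spread + p.κ₂ * Real.sqrt p.spread +
      (2 * p.κ₁ * Real.sqrt p.spread + p.κ₂) * (p.κ₁ * Real.sqrt p.spread + 2 * p.κ₂)) /
        (1 - (p.H - 1 / 2)))

lemma Params.Valid.stepOneBound_nonneg (hp : p.Valid) : 0 ≤ p.stepOneBound := by
  have := hp.spread_nonneg
  have := p.κ₁_nonneg
  have := p.κ₂_nonneg
  have : 0 < 1 - (p.H - 1 / 2) := by linarith [hp.hH.2]
  unfold Params.stepOneBound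
  positivity

lemma Params.Valid.lintegral_stepOneDrift_le (hp : p.Valid) {q : Paths d} {τ : ℝ}
    (hadm : Admissible p q τ) {w gh : ℝ → Vec d} (h : IsStepOneDrift p q τ w gh) :
    ∫⁻ t in Ioc (0 : ℝ) 1, ‖gh t‖ₑ ≤ ENNReal.ofReal p.stepOneBound := by
  obtain ⟨y, ρ, hy, hρ, -, hρ', hgh⟩ := h
  obtain ⟨hmem, hX⟩ := hadm
  have hκ₁ := p.κ₁_nonneg
  have hκ₂ := p.κ₂_nonneg
  have hsp := hp.spread_nonneg
  have ha : 0 < 1 - (p.H - 1 / 2) := by linarith [hp.hH.2]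
  set R := p.spread with hR
  have hρ₀ : ‖p.hLoc (q.X 1 τ) - p.hLoc (q.X 0 τ)‖ ≤ R := hp.norm_hLoc_sub_le (hX 0).1 (hX 1).1
  have hρ'' : ∀ t ∈ Icc (0 : ℝ) 1, ρ t = (p.hLoc (q.X 1 τ) - p.hLoc (q.X 0 τ)) +
      ∫ s in (0 : ℝ)..t, p.companionVelocity y ρ s := hρ'
  have hρR : ∀ t ∈ Icc (0 : ℝ) 1, ‖ρ t‖ ≤ R := fun t ht => by
    have h0 := hρ'' 0 (by simp)
    simp only [intervalIntegral.integral_same, add_zero] at h0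
    rw [← h0] at hρ₀
    exact (hp.antitoneOn_norm_companion hy hρ hρ'' (by simp) ht ht.1).trans hρ₀
  set M := p.κ₁ * R + p.κ₂ * Real.sqrt R with hM
  set Λ := (2 * p.κ₁ * Real.sqrt R + p.κ₂) * (p.κ₁ * Real.sqrt R + 2 * p.κ₂) with hΛ
  have hM0 : 0 ≤ M := by positivity
  have hΛ0 : 0 ≤ Λ := by positivity
  have hder : ∀ t ∈ Ioo (0 : ℝ) 1, ‖deriv (fun r => ∫ s in (0 : ℝ)..r,
      (r - s) ^ (1 / 2 - p.H) • p.feedback (ρ s)) t‖ ≤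
      M * t ^ (-(p.H - 1 / 2)) + Λ / (1 - (p.H - 1 / 2)) := by
    rw [show 1 / 2 - p.H = -(p.H - 1 / 2) by ring]
    intro t ht
    refine norm_deriv_fractional_integral_le (F := fun s => p.feedback (ρ s))
      (by linarith [hp.hH.1]) (by linarith [hp.hH.2])
      (Params.continuous_feedback.comp_continuousOn hρ) (fun t ht => ?_)
      (fun s t hs hst ht => hp.norm_feedback_companion_sub_le hy hρ hρ'' hρ₀ hs hst ht) ht
    refine (p.norm_feedback_le _).trans ?_
    have h1 := hρR t ht
    have h2 := Real.sqrt_le_sqrt h1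
    rw [hM]
    gcongr
  set c := p.abelConst / (alphaH p.H * (p.H - 1 / 2)) with hc
  have hae : ∀ᵐ t ∂volume.restrict (Ioc (0 : ℝ) 1), ‖gh t‖ₑ ≤
      ENNReal.ofReal |p.abelConst| * ‖memOp p.H 0 (fun s => q.g (s + τ)) t‖ₑ +
        ENNReal.ofReal (|c| * (M * t ^ (-(p.H - 1 / 2)) + Λ / (1 - (p.H - 1 / 2)))) := by
    rw [← restrict_Ioo_eq_restrict_Ioc] at hgh ⊢
    filter_upwards [hgh, ae_restrict_mem measurableSet_Ioo] with t ht htm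
    rw [ht]
    refine (enorm_add_le _ _).trans (add_le_add (le_of_eq ?_) ?_)
    · rw [enorm_neg, enorm_smul, Real.enorm_eq_ofReal_abs]
    · rw [← ofReal_norm, norm_smul, Real.norm_eq_abs]
      refine ENNReal.ofReal_le_ofReal ?_
      have := hder t htm
      gcongr
  have hint : IntervalIntegrable (fun t : ℝ => |c| * (M * t ^ (-(p.H - 1 / 2)) +
      Λ / (1 - (p.H - 1 / 2)))) volume 0 1 :=
    (((intervalIntegral.intervalIntegrable_rpow' (by linarith)).const_mul _).add
      intervalIntegrable_const).const_mul _
  have hreal : ∫⁻ t in Ioc (0 : ℝ) 1, ENNReal.ofReal (|c| * (M * t ^ (-(p.H - 1 / 2)) +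
      Λ / (1 - (p.H - 1 / 2)))) = ENNReal.ofReal (|c| * ((M + Λ) / (1 - (p.H - 1 / 2)))) := by
    rw [← ofReal_integral_eq_lintegral_ofReal
      ((intervalIntegrable_iff_integrableOn_Ioc_of_le zero_le_one).1 hint),
      ← intervalIntegral.integral_of_le zero_le_one, intervalIntegral.integral_const_mul,
      intervalIntegral.integral_add
        ((intervalIntegral.intervalIntegrable_rpow' (by linarith)).const_mul _)
        intervalIntegrable_const, intervalIntegral.integral_const_mul,
      integral_rpow (Or.inl (by linarith))]
    · congr 2
      rw [Real.one_rpow, Real.zero_rpow (by linarith),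
        show -(p.H - 1 / 2) + 1 = 1 - (p.H - 1 / 2) by ring]
      simp only [intervalIntegral.integral_const, smul_eq_mul]
      ring
    · filter_upwards [ae_restrict_mem measurableSet_Ioc] with t ht
      have := ht.1
      positivity
  have hL1 := hmem.lintegral_memOp_le hp.hα.1.le (T := 0) (L := 1) le_rfl zero_le_one
  rw [Real.sqrt_one] at hL1
  calc ∫⁻ t in Ioc (0 : ℝ) 1, ‖gh t‖ₑ ≤ _ := lintegral_mono_ae hae
    _ = ENNReal.ofReal |p.abelConst| *
          (∫⁻ t in Ioc (0 : ℝ) 1, ‖memOp p.H 0 (fun s => q.g (s + τ)) t‖ₑ) +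
          ENNReal.ofReal (|c| * ((M + Λ) / (1 - (p.H - 1 / 2)))) := by
        rw [lintegral_add_right, lintegral_const_mul' _ _ ENNReal.ofReal_ne_top, hreal]
        fun_prop
    _ ≤ ENNReal.ofReal |p.abelConst| * ENNReal.ofReal 1 +
          ENNReal.ofReal (|c| * ((M + Λ) / (1 - (p.H - 1 / 2)))) := by gcongr
    _ = ENNReal.ofReal p.stepOneBound := by
        rw [ENNReal.ofReal_one, mul_one, ← ENNReal.ofReal_add (abs_nonneg _) (by positivity)]
        rfl

lemma Params.Valid.lintegral_stepOne_le (hp : p.Valid) {q : Paths d} {τ : ℝ}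
    (h : StepOne p q τ) :
    ∫⁻ t in Ioc τ (τ + 1), ‖q.g t‖ₑ ≤ ENNReal.ofReal p.stepOneBound := by
  have hzero : (∀ᵐ t ∂volume.restrict (Ioc τ (τ + 1)), q.g t = 0) →
      ∫⁻ t in Ioc τ (τ + 1), ‖q.g t‖ₑ ≤ ENNReal.ofReal p.stepOneBound := fun h0 => by
    rw [lintegral_congr_ae (g := fun _ => 0) (h0.mono fun t ht => by simp [ht])]
    simp
  by_cases hadm : Admissible p q τ
  swap
  · exact hzero (h.1 hadm)
  have hshift : ∫⁻ t in Ioc τ (τ + 1), ‖q.g t‖ₑ = ∫⁻ t in Ioc (0 : ℝ) 1, ‖q.g (t + τ)‖ₑ := by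
    rw [setLIntegral_Ioc_comp_add_right (fun t => ‖q.g t‖ₑ), zero_add, add_comm 1]
  rcases h.2 hadm with h1 | h1 | h1
  · rw [hshift]; exact hp.lintegral_stepOneDrift_le hadm h1
  · rw [hshift]; simpa using hp.lintegral_stepOneDrift_le hadm h1
  · exact hzero h1

/-! ### The memory kernel -/

lemma integrableOn_rpow_mul_one_add_rpow {a b : ℝ} (ha : -1 < a) (hb : b ≤ 0) (hab : a + b < -1) :
    IntegrableOn (fun x : ℝ => x ^ a * (1 + x) ^ b) (Ioi 0) := by
  have hmeas : Measurable (fun x : ℝ => x ^ a * (1 + x) ^ b) := by fun_prop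
  rw [← Ioc_union_Ioi_eq_Ioi (zero_le_one (α := ℝ))]
  refine IntegrableOn.union ?_ ?_
  · have h1 : IntegrableOn (fun x : ℝ => x ^ a) (Ioc 0 1) :=
      (intervalIntegrable_iff_integrableOn_Ioc_of_le zero_le_one).1
        (intervalIntegral.intervalIntegrable_rpow' ha)
    refine h1.mono' hmeas.aestronglyMeasurable ?_
    filter_upwards [ae_restrict_mem measurableSet_Ioc] with x hx
    have hx0 := hx.1
    rw [Real.norm_of_nonneg (by positivity)]
    exact mul_le_of_le_one_right (by positivity)
      (Real.rpow_le_one_of_one_le_of_nonpos (by linarith) hb)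
  · refine (integrableOn_Ioi_rpow_of_lt hab zero_lt_one).mono' hmeas.aestronglyMeasurable ?_
    filter_upwards [ae_restrict_mem measurableSet_Ioi] with x hx
    have hx0 : 0 < x := zero_lt_one.trans hx
    rw [Real.norm_of_nonneg (by positivity), Real.rpow_add hx0]
    have := Real.rpow_le_rpow_of_nonpos hx0 (show x ≤ 1 + x by linarith) hb
    gcongr

lemma memKernel_nonneg {H T t s : ℝ} (hT : 0 ≤ T) (ht : 0 < t) (hs : s ≤ 0) :
    0 ≤ memKernel H T t s := by
  have h1 : 0 ≤ T - s := by linarith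
  have h2 : 0 ≤ t + T - s := by linarith
  unfold memKernel
  positivity

lemma measurable_memKernel (H T : ℝ) : Measurable fun z : ℝ × ℝ => memKernel H T z.1 z.2 := by
  unfold memKernel
  fun_prop

lemma measurable_memKernel_right (H T t : ℝ) : Measurable (memKernel H T t) := by
  unfold memKernel
  fun_prop

/-- The integral `∫_0^∞ x^(1/2-H) / (1+x) dx`. As the kernel of `R_0` is homogeneous of degree `-1`,
this is the norm of `R_0` as an operator on `L¹`. -/
noncomputable def columnMass (H : ℝ) : ℝ := ∫ x in Ioi (0 : ℝ), x ^ (1 / 2 - H) * (1 + x) ^ (-1 : ℝ)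

lemma columnMass_nonneg (H : ℝ) : 0 ≤ columnMass H :=
  setIntegral_nonneg measurableSet_Ioi fun x (hx : 0 < x) => by positivity

lemma lintegral_memKernel_le {H : ℝ} (hH : H ∈ Ioo (1 / 2) (1 : ℝ)) {s : ℝ} (hs : s ≤ 0) :
    ∫⁻ t in Ioi (0 : ℝ), ENNReal.ofReal (memKernel H 0 t s) ≤ ENNReal.ofReal (columnMass H) := by
  rcases hs.eq_or_lt with rfl | hs
  · have h0 : ∀ t, memKernel H 0 t 0 = 0 := fun t => by
      unfold memKernel
      rw [sub_zero, Real.zero_rpow (by linarith [hH.1]), mul_zero, zero_div]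
    simp [h0]
  set u := -s with hu
  have hu0 : 0 < u := by linarith
  have hint := integrableOn_rpow_mul_one_add_rpow (a := 1 / 2 - H) (b := -1)
    (by linarith [hH.2]) (by norm_num) (by linarith [hH.1])
  have hker : ∀ t ∈ Ioi (0 : ℝ), memKernel H 0 t s =
      u⁻¹ * ((u⁻¹ * t) ^ (1 / 2 - H) * (1 + u⁻¹ * t) ^ (-1 : ℝ)) := by
    intro t (ht : 0 < t)
    have hsu : s = -u := by rw [hu, neg_neg]
    have e1 : (u⁻¹ * t) ^ (1 / 2 - H) = u ^ (H - 1 / 2) * t ^ (1 / 2 - H) := by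
      rw [Real.mul_rpow (by positivity) ht.le, Real.inv_rpow hu0.le, ← Real.rpow_neg hu0.le, neg_sub]
    have e2 : 1 + u⁻¹ * t = u⁻¹ * (t + u) := by field_simp; ring
    rw [memKernel, e1, e2, Real.rpow_neg_one, hsu, zero_sub, neg_neg, add_zero, sub_neg_eq_add]
    field_simp
  have hint' : IntegrableOn (fun t => u⁻¹ * ((u⁻¹ * t) ^ (1 / 2 - H) *
      (1 + u⁻¹ * t) ^ (-1 : ℝ))) (Ioi 0) := by
    refine Integrable.const_mul ?_ _
    exact (integrableOn_Ioi_comp_mul_left_iff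
      (fun x : ℝ => x ^ (1 / 2 - H) * (1 + x) ^ (-1 : ℝ)) 0 (inv_pos.2 hu0)).2 (by simpa using hint)
  rw [setLIntegral_congr_fun measurableSet_Ioi fun t ht => congrArg ENNReal.ofReal (hker t ht),
    ← ofReal_integral_eq_lintegral_ofReal hint']
  · refine ENNReal.ofReal_le_ofReal (le_of_eq ?_)
    rw [integral_const_mul, integral_comp_mul_left_Ioi
      (fun x : ℝ => x ^ (1 / 2 - H) * (1 + x) ^ (-1 : ℝ)) 0 (inv_pos.2 hu0), mul_zero, inv_inv,
      smul_eq_mul, ← mul_assoc, inv_mul_cancel₀ hu0.ne', one_mul, columnMass]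
  · filter_upwards [ae_restrict_mem measurableSet_Ioi] with t ht
    have ht0 : 0 < t := ht
    positivity

lemma aestronglyMeasurable_comp_add_right {E : Type*} [NormedAddCommGroup E] {g : ℝ → E}
    (hg : AEStronglyMeasurable g) (c : ℝ) : AEStronglyMeasurable fun s => g (s + c) :=
  hg.comp_quasiMeasurePreserving (measurePreserving_add_right volume c).quasiMeasurePreserving

lemma aestronglyMeasurable_memOp {g : ℝ → Vec d} (hg : AEStronglyMeasurable g) (H T : ℝ) :
    AEStronglyMeasurable (memOp H T g) := by
  unfold memOp
  refine AEStronglyMeasurable.integral_prod_right' (μ := volume)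
    (ν := volume.restrict (Iic (0 : ℝ))) (f := fun z : ℝ × ℝ => memKernel H T z.1 z.2 • g z.2) ?_
  exact (measurable_memKernel H T).aestronglyMeasurable.smul hg.restrict.comp_snd

/-! ### The sticky drift -/

/-- One time unit later, the memory splits into the old memory, which is `R_1`, and the memory of
the last time unit. -/
lemma enorm_memOp_add_one_le {H α : ℝ} {g : ℝ → Vec d} (hg : MemoryCond H α g)
    (hm : AEStronglyMeasurable g) {t : ℝ} (ht : 0 < t) :
    ‖memOp H 0 (fun s => g (s + 1)) t‖ₑ ≤ ‖memOp H 1 g t‖ₑ +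
      ∫⁻ s in Ioc (-1 : ℝ) 0, ENNReal.ofReal (memKernel H 0 t s) * ‖g (s + 1)‖ₑ := by
  set I := ∫⁻ s in Ioc (-1 : ℝ) 0, ENNReal.ofReal (memKernel H 0 t s) * ‖g (s + 1)‖ₑ with hI
  rcases eq_or_ne I ⊤ with htop | htop
  · simp [htop]
  have hker : ∀ s, memKernel H 0 t s = memKernel H 1 t (s + 1) := fun s => by
    unfold memKernel
    rw [show (1 : ℝ) - (s + 1) = 0 - s by ring, show t + 1 - (s + 1) = t + 0 - s by ring]
  have hmeas : AEStronglyMeasurable fun s => memKernel H 0 t s • g (s + 1) :=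
    (measurable_memKernel_right H 0 t).aestronglyMeasurable.smul
      (aestronglyMeasurable_comp_add_right hm 1)
  have hnorm : ∫⁻ s in Ioc (-1 : ℝ) 0, ‖memKernel H 0 t s • g (s + 1)‖ₑ = I := by
    refine setLIntegral_congr_fun measurableSet_Ioc fun s hs => ?_
    simp only [enorm_smul, Real.enorm_of_nonneg (memKernel_nonneg le_rfl ht hs.2)]
  have hint1 : IntegrableOn (fun s => memKernel H 0 t s • g (s + 1)) (Ioc (-1) 0) :=
    ⟨hmeas.restrict, by rw [HasFiniteIntegral, hnorm]; exact htop.lt_top⟩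
  have hpre : (fun s : ℝ => s + 1) ⁻¹' Iic 0 = Iic (-1) := by 
    ext s
    simp [le_neg_iff_add_nonpos_left, add_comm]
  have hemb := (MeasurableEquiv.addRight (1 : ℝ)).measurableEmbedding
  have hmp := measurePreserving_add_right volume (1 : ℝ)
  have hint2 : IntegrableOn (fun s => memKernel H 0 t s • g (s + 1)) (Iic (-1)) := by
    have := (hmp.integrableOn_comp_preimage hemb (s := Iic 0)
      (f := fun s => memKernel H 1 t s • g s)).2 (hg.1 1 zero_le_one t ht)
    rw [hpre] at this
    exact this.congr_fun (fun s _ => by simp [hker]) measurableSet_Iic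
  have hval : ∫ s in Iic (-1 : ℝ), memKernel H 0 t s • g (s + 1) = memOp H 1 g t := by
    have := hmp.setIntegral_preimage_emb hemb (fun s => memKernel H 1 t s • g s) (Iic 0)
    rw [hpre] at this
    rw [memOp, ← this]
    simp only [hker]
  have hsplit : memOp H 0 (fun s => g (s + 1)) t = memOp H 1 g t +
      ∫ s in Ioc (-1 : ℝ) 0, memKernel H 0 t s • g (s + 1) := by
    rw [← hval, ← setIntegral_union (Iic_disjoint_Ioc le_rfl) measurableSet_Ioc hint2 hint1,
      Iic_union_Ioc_eq_Iic (by norm_num), memOp]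
  rw [hsplit]
  exact (enorm_add_le _ _).trans
    (add_le_add le_rfl ((enorm_integral_le_lintegral_enorm _).trans hnorm.le))

lemma lintegral_memOp_add_one_le {H α : ℝ} {g : ℝ → Vec d} (hH : H ∈ Ioo (1 / 2) (1 : ℝ))
    (hα : 0 ≤ α) (hg : MemoryCond H α g) (hm : AEStronglyMeasurable g) {L : ℝ} (hL : 0 ≤ L) :
    ∫⁻ t in Ioc 0 L, ‖memOp H 0 (fun s => g (s + 1)) t‖ₑ ≤ ENNReal.ofReal (Real.sqrt L) +
      ENNReal.ofReal (columnMass H) * ∫⁻ s in Ioc (0 : ℝ) 1, ‖g s‖ₑ := by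
  have hmk : Measurable fun z : ℝ × ℝ => ENNReal.ofReal (memKernel H 0 z.1 z.2) :=
    (measurable_memKernel H 0).ennreal_ofReal
  have hmg : AEMeasurable (fun s => ‖g (s + 1)‖ₑ) :=
    (aestronglyMeasurable_comp_add_right hm 1).enorm
  calc ∫⁻ t in Ioc 0 L, ‖memOp H 0 (fun s => g (s + 1)) t‖ₑ
      ≤ ∫⁻ t in Ioc 0 L, (‖memOp H 1 g t‖ₑ +
        ∫⁻ s in Ioc (-1 : ℝ) 0, ENNReal.ofReal (memKernel H 0 t s) * ‖g (s + 1)‖ₑ) :=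
        setLIntegral_mono' measurableSet_Ioc fun t ht => enorm_memOp_add_one_le hg hm ht.1
    _ = (∫⁻ t in Ioc 0 L, ‖memOp H 1 g t‖ₑ) + ∫⁻ t in Ioc 0 L,
        ∫⁻ s in Ioc (-1 : ℝ) 0, ENNReal.ofReal (memKernel H 0 t s) * ‖g (s + 1)‖ₑ :=
        lintegral_add_left' (aestronglyMeasurable_memOp hm H 1).enorm.restrict _
    _ ≤ ENNReal.ofReal (Real.sqrt L) + ENNReal.ofReal (columnMass H) *
        ∫⁻ s in Ioc (0 : ℝ) 1, ‖g s‖ₑ := by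
        refine add_le_add (hg.lintegral_memOp_le hα zero_le_one hL) ?_
        rw [lintegral_lintegral_swap (hmk.aemeasurable.mul hmg.restrict.comp_snd),
          show (Ioc (0 : ℝ) 1) = Ioc (-1 + 1) (0 + 1) by norm_num,
          ← setLIntegral_Ioc_comp_add_right (fun s => ‖g s‖ₑ),
          ← lintegral_const_mul' _ _ ENNReal.ofReal_ne_top]
        refine setLIntegral_mono' measurableSet_Ioc fun s hs => ?_
        rw [lintegral_mul_const _ (by unfold memKernel; fun_prop)]
        gcongr
        exact (lintegral_mono_set Ioc_subset_Ioi_self).trans (lintegral_memKernel_le hH hs.2)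

lemma aestronglyMeasurable_stickyDrift {q : Paths d} (hm : AEStronglyMeasurable q.g) (τ : ℝ) :
    AEStronglyMeasurable (stickyDrift p q τ) := by
  have h1 := aestronglyMeasurable_memOp (aestronglyMeasurable_comp_add_right hm (τ + 1)) p.H 0
  exact ((aestronglyMeasurable_comp_add_right h1 (-(τ + 1))).const_smul p.abelConst).neg

lemma Params.Valid.lintegral_stickyDrift_le (hp : p.Valid) {q : Paths d} {τ : ℝ}
    (hm : AEStronglyMeasurable q.g) (hadm : Admissible p q τ) (h1 : StepOne p q τ)
    {L : ℝ} (hL : 0 ≤ L) :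
    ∫⁻ t in Ioc (τ + 1) (τ + 1 + L), ‖stickyDrift p q τ t‖ₑ ≤
      ENNReal.ofReal (|p.abelConst| * (Real.sqrt L + columnMass p.H * p.stepOneBound)) := by
  have hmτ := aestronglyMeasurable_comp_add_right hm τ
  have key := lintegral_memOp_add_one_le hp.hH hp.hα.1.le hadm.1 hmτ hL
  have hone : ∫⁻ s in Ioc (0 : ℝ) 1, ‖q.g (s + τ)‖ₑ ≤ ENNReal.ofReal p.stepOneBound := by
    rw [setLIntegral_Ioc_comp_add_right (fun t => ‖q.g t‖ₑ), zero_add, add_comm 1]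
    exact hp.lintegral_stepOne_le h1
  have e : ∫⁻ t in Ioc (τ + 1) (τ + 1 + L), ‖stickyDrift p q τ t‖ₑ = ENNReal.ofReal |p.abelConst| *
      ∫⁻ t in Ioc 0 L, ‖memOp p.H 0 (fun s => q.g (s + 1 + τ)) t‖ₑ := by
    have hs := setLIntegral_Ioc_comp_add_right (fun t => ‖stickyDrift p q τ t‖ₑ) 0 L (τ + 1)
    rw [zero_add, add_comm L] at hs
    rw [← hs, ← lintegral_const_mul' _ _ ENNReal.ofReal_ne_top]
    refine lintegral_congr fun t => ?_
    have hτ : ∀ s, s + (τ + 1) = s + 1 + τ := fun s => by ring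
    rw [stickyDrift, enorm_neg, enorm_smul, Real.enorm_eq_ofReal_abs, add_sub_cancel_right]
    simp only [hτ]
  rw [e]
  calc _ ≤ ENNReal.ofReal |p.abelConst| * (ENNReal.ofReal (Real.sqrt L) +
        ENNReal.ofReal (columnMass p.H) * ENNReal.ofReal p.stepOneBound) := by
        gcongr
        exact key.trans (by gcongr)
    _ = _ := by
        have := columnMass_nonneg p.H
        have := hp.stepOneBound_nonneg
        rw [← ENNReal.ofReal_mul (columnMass_nonneg _), ← ENNReal.ofReal_add (by positivity) (by positivity),
          ← ENNReal.ofReal_mul (abs_nonneg _)]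

/-! ### The drift of Step 2 -/

lemma ae_eq_of_intervalIntegral_eq {E : Type*} [NormedAddCommGroup E] [NormedSpace ℝ E]
    [CompleteSpace E] {f g : ℝ → E} {a b : ℝ} (hab : a ≤ b) (hf : IntervalIntegrable f volume a b)
    (hg : IntervalIntegrable g volume a b)
    (h : ∀ t ∈ Icc a b, ∫ s in a..t, f s = ∫ s in a..t, g s) :
    ∀ᵐ t ∂volume.restrict (Ioc a b), f t = g t := by
  rw [← restrict_Ioo_eq_restrict_Ioc, ae_restrict_iff' measurableSet_Ioo]
  filter_upwards [(hf.sub hg).ae_hasDerivAt_integral] with t ht hmem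
  rw [uIcc_of_le hab] at ht
  have h1 := ht (Ioo_subset_Icc_self hmem) a ⟨le_rfl, hab⟩
  have h2 : HasDerivAt (fun x => ∫ s in a..x, f s - g s) 0 t := by
    refine (hasDerivAt_const t (0 : E)).congr_of_eventuallyEq ?_
    filter_upwards [Icc_mem_nhds hmem.1 hmem.2] with x hx
    have hsub : uIcc a x ⊆ uIcc a b := by
      rw [uIcc_of_le hx.1, uIcc_of_le hab]; exact Icc_subset_Icc_right hx.2
    rw [intervalIntegral.integral_sub (hf.mono_set hsub) (hg.mono_set hsub), h x hx, sub_self]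
  exact sub_eq_zero.1 (h1.unique h2)

lemma attemptStart_le_succ {c₂ : ℝ} (hc : 0 ≤ c₂) (τ : ℝ) :
    ∀ ℓ, attemptStart c₂ τ ℓ ≤ attemptStart c₂ τ (ℓ + 1)
  | 0 => le_rfl
  | (n + 1) => by
    simp only [attemptStart]
    linarith [show 0 ≤ c₂ * 2 ^ (n + 1) by positivity]

lemma attemptStart_mono {c₂ : ℝ} (hc : 0 ≤ c₂) (τ : ℝ) : Monotone (attemptStart c₂ τ) :=
  monotone_nat_of_le_succ (attemptStart_le_succ hc τ)

lemma attemptStart_succ (c₂ τ : ℝ) (n : ℕ) :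
    attemptStart c₂ τ (n + 1) = τ + 1 + c₂ * (2 ^ (n + 1) - 2) := by
  induction n with
  | zero => simp [attemptStart]
  | succ n ih => rw [attemptStart, ih]; ring

lemma le_attemptStart {c₂ : ℝ} (hc : 0 ≤ c₂) (τ : ℝ) (ℓ : ℕ) :
    τ + 1 ≤ attemptStart c₂ τ ℓ :=
  attemptStart_mono hc τ (Nat.zero_le ℓ)

/-- On each line of the Gaussian coupling the drift is a multiple of the sticky drift: the multiple
is `1` or `0`, or its `L²` norm is at most the truncation level. -/
lemma lintegral_attempt_le {q : Paths d} {τ : ℝ} {ℓ : ℕ} (hc : 0 ≤ p.c₂)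
    (htr : 0 < p.truncation ℓ) (hg : LocallyIntegrable q.g)
    (hW : ∀ s t : ℝ, q.W 1 t - q.W 1 s = q.W 0 t - q.W 0 s + ∫ r in s..t, q.g r)
    (hS : IntegrableOn (stickyDrift p q τ)
      (Ioc (attemptStart p.c₂ τ ℓ) (attemptStart p.c₂ τ (ℓ + 1))))
    (h : StepTwoAttempt p q τ ℓ) :
    ∫⁻ t in Ioc (attemptStart p.c₂ τ ℓ) (attemptStart p.c₂ τ (ℓ + 1)), ‖q.g t‖ₑ ≤
      (∫⁻ t in Ioc (attemptStart p.c₂ τ ℓ) (attemptStart p.c₂ τ (ℓ + 1)), ‖stickyDrift p q τ t‖ₑ) +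
      ENNReal.ofReal (Real.sqrt (attemptStart p.c₂ τ (ℓ + 1) - attemptStart p.c₂ τ ℓ) *
        p.truncation ℓ) := by
  obtain ⟨U, Z, hU, hUZ⟩ := h
  have hss' := attemptStart_le_succ hc τ ℓ
  set s := attemptStart p.c₂ τ ℓ
  set s' := attemptStart p.c₂ τ (ℓ + 1)
  set S := stickyDrift p q τ
  set M := p.truncation ℓ
  set a := Real.sqrt (∫ t in s..s', ‖S t‖ ^ 2) with ha
  have hSi : IntervalIntegrable S volume s s' :=
    (intervalIntegrable_iff_integrableOn_Ioc_of_le hss').2 hS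
  set c := (U 1 - U 0) * a⁻¹ with hcdef
  have hae : ∀ᵐ t ∂volume.restrict (Ioc s s'), q.g t = c • S t := by
    refine ae_eq_of_intervalIntegral_eq hss'
      (hg.integrableOn_isCompact isCompact_uIcc).intervalIntegrable (hSi.smul c) fun t ht => ?_
    have h0 := hUZ 0 t ht
    have h1 := hUZ 1 t ht
    have h2 := hW s t
    rw [h0, h1] at h2
    rw [intervalIntegral.integral_smul, hcdef, mul_smul, sub_smul]
    have h3 : ∫ r in s..t, q.g r = (U 1 • (a⁻¹ • ∫ r in s..t, S r) + Z t) -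
      (U 0 • (a⁻¹ • ∫ r in s..t, S r) + Z t) := by rw [h2]; abel
    rw [h3]; abel
  have hgS : ∫⁻ t in Ioc s s', ‖q.g t‖ₑ =
      ENNReal.ofReal |c| * ∫⁻ t in Ioc s s', ‖S t‖ₑ := by
    rw [← lintegral_const_mul' _ _ ENNReal.ofReal_ne_top]
    refine lintegral_congr_ae (hae.mono fun t ht => ?_)
    simp only [ht, enorm_smul, Real.enorm_eq_ofReal_abs]
  rw [hgS]
  rcases hU with (hU | ⟨hU, hM⟩) | hU
  · have hle : |c| ≤ 1 := by
      have hU : U 1 = U 0 + a := hU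
      rw [hcdef, hU, add_sub_cancel_left]
      rcases eq_or_ne a 0 with h0 | h0
      · simp [h0]
      · simp [mul_inv_cancel₀ h0]
    refine le_add_right ?_
    exact mul_le_of_le_one_left' (by rw [← ENNReal.ofReal_one]; exact ENNReal.ofReal_le_ofReal hle)
  · refine le_add_left ?_
    have ha0 : 0 ≤ a := Real.sqrt_nonneg _
    rcases ha0.eq_or_lt with h0 | hpos
    -- `a = 0`, also as the junk value of an infinite `L²` norm, makes the multiple zero
    · have : c = 0 := by rw [hcdef, ← h0, inv_zero, mul_zero]
      simp [this]
    have hU : U 1 = -U 0 := hU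
    have hM : |U 0| ≤ M / 2 := hM
    have hcM : |c| ≤ M / a := by
      rw [hcdef, hU, abs_mul, abs_inv, abs_of_pos hpos, ← div_eq_mul_inv]
      gcongr
      rw [show -U 0 - U 0 = -(2 * U 0) by ring, abs_neg, abs_mul, abs_two]
      linarith
    have hI : 0 < ∫ t in s..s', ‖S t‖ ^ 2 := Real.sqrt_pos.1 hpos
    have haa : a ^ 2 = ∫ t in s..s', ‖S t‖ ^ 2 := Real.sq_sqrt hI.le
    have hint : IntegrableOn (fun t => ‖S t‖ ^ 2) (Ioc s s') := by
      rw [← intervalIntegrable_iff_integrableOn_Ioc_of_le hss']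
      by_contra hn
      rw [intervalIntegral.integral_undef hn] at hI
      exact lt_irrefl _ hI
    have hsq : ∫⁻ t in Ioc s s', ‖S t‖ₑ ^ 2 ≤ ENNReal.ofReal (a ^ 2) := by
      rw [haa, intervalIntegral.integral_of_le hss',
        ofReal_integral_eq_lintegral_ofReal hint (Filter.Eventually.of_forall fun t => by positivity)]
      refine lintegral_mono fun t => ?_
      rw [← ofReal_norm, ENNReal.ofReal_pow (norm_nonneg _)]
    calc ENNReal.ofReal |c| * ∫⁻ t in Ioc s s', ‖S t‖ₑ
        ≤ ENNReal.ofReal (M / a) * ENNReal.ofReal (Real.sqrt (s' - s) * a) := by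
          gcongr
          exact lintegral_enorm_le_of_lintegral_sq_le hss' hpos hsq
      _ = _ := by
          rw [← ENNReal.ofReal_mul (by positivity)]
          congr 1; field_simp
  · simp only [mem_ofPred_eq] at hU
    simp [hcdef, hU]

/-- The factor in the linear bound of the truncation levels. -/
noncomputable def Params.truncationRate (p : Params d) : ℝ :=
  p.M₁ + 4 + 2 * Real.log 8 + 2 * p.α * Real.log 2

lemma Params.Valid.truncation_pos (hp : p.Valid) (ℓ : ℕ) : 0 < p.truncation ℓ := by
  unfold Params.truncation
  split_ifs
  · exact hp.hM₁
  · exact lt_max_of_lt_left (by positivity)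

lemma Params.Valid.truncation_le (hp : p.Valid) (ℓ : ℕ) :
    p.truncation ℓ ≤ p.truncationRate * (1 + ℓ) := by
  have h8 : 0 ≤ Real.log 8 := Real.log_nonneg (by norm_num)
  have h2 : 0 ≤ Real.log 2 := Real.log_nonneg (by norm_num)
  have hM := hp.hM₁.le
  have hα := hp.hα.1.le
  have hℓ : (0 : ℝ) ≤ ℓ := by positivity
  have hα2 : 0 ≤ p.α * Real.log 2 := by positivity
  have hb : (2 : ℝ) ^ (-(p.α * ℓ)) ≤ 1 :=
    Real.rpow_le_one_of_one_le_of_nonpos (by norm_num) (by simp; positivity)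
  unfold Params.truncation Params.truncationRate
  split_ifs
  · nlinarith
  · refine max_le (by nlinarith) ?_
    rw [Real.log_div (by positivity) (by norm_num), Real.log_rpow (by norm_num)]
    nlinarith

/-! ### The drift of a whole trial -/

/-- The factor in the bound `C (1 + ℓ) 2^(ℓ/2)` of the drift, in `L¹`, of a trial that fails at
attempt `ℓ`. -/
noncomputable def Params.trialBound (p : Params d) : ℝ :=
  p.stepOneBound + |p.abelConst| * (Real.sqrt (2 * p.c₂) + columnMass p.H * p.stepOneBound) +
    Real.sqrt p.c₂ * p.truncationRate

lemma Params.Valid.truncationRate_nonneg (hp : p.Valid) : 0 ≤ p.truncationRate := by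
  have := hp.truncation_le 0
  have h2 := hp.truncation_pos 0
  simp at this
  linarith

lemma Params.Valid.trialBound_nonneg (hp : p.Valid) : 0 ≤ p.trialBound := by
  have := hp.stepOneBound_nonneg
  have := columnMass_nonneg p.H
  have := hp.truncationRate_nonneg
  unfold Params.trialBound
  positivity

lemma ae_eq_stickyDrift {q : Paths d} {τ : ℝ} (hc : 0 ≤ p.c₂) (n : ℕ)
    (h : ∀ i, 1 ≤ i → i < n + 1 → AttemptSucceeds p q τ i) :
    ∀ᵐ t ∂volume.restrict (Ioc (τ + 1) (attemptStart p.c₂ τ (n + 1))),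
      q.g t = stickyDrift p q τ t := by
  induction n with
  | zero => simp [attemptStart]
  | succ n ih =>
    have h1 := ih fun i hi hin => h i hi (by omega)
    have h2 := h (n + 1) (by omega) (by omega)
    rw [← Ioc_union_Ioc_eq_Ioc (le_attemptStart hc τ (n + 1)) (attemptStart_le_succ hc τ (n + 1)),
      ae_restrict_union_iff]
    exact ⟨h1, h2⟩

lemma Params.Valid.lintegral_trial_le (hp : p.Valid) {q : Paths d} {c₃ : ℝ} {k ℓ : ℕ} {τ : ℝ≥0}
    {τ' : WithTop ℝ≥0} (hg : LocallyIntegrable q.g)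
    (hW : ∀ s t : ℝ, q.W 1 t - q.W 1 s = q.W 0 t - q.W 0 s + ∫ r in s..t, q.g r)
    (h : FollowsTrial p c₃ k q τ τ') (hℓ : FailsAt p q τ ℓ) :
    ∫⁻ t in Ioc (τ : ℝ) (attemptStart p.c₂ τ (ℓ + 1)), ‖q.g t‖ₑ ≤
      ENNReal.ofReal (p.trialBound * ((1 + ℓ) * Real.sqrt (2 ^ ℓ))) := by
  have hc : 0 ≤ p.c₂ := by linarith [hp.hc₂]
  have hone := hp.lintegral_stepOne_le h.stepOne
  have hN1 := hp.stepOneBound_nonneg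
  have hcm := columnMass_nonneg p.H
  have htr := hp.truncationRate_nonneg
  rcases ℓ with _ | n
  · simp only [attemptStart]
    refine hone.trans (ENNReal.ofReal_le_ofReal ?_)
    simp only [Nat.cast_zero, add_zero, pow_zero, Real.sqrt_one, mul_one, Params.trialBound]
    have : 0 ≤ |p.abelConst| * (Real.sqrt (2 * p.c₂) + columnMass p.H * p.stepOneBound) +
        Real.sqrt p.c₂ * p.truncationRate := by positivity
    linarith
  obtain ⟨⟨hsucc, hprev⟩, -⟩ := hℓ
  have htwo := h.stepTwo (n + 1) (by omega) ⟨hsucc, hprev⟩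
  set s := attemptStart p.c₂ τ (n + 1) with hs
  set s' := attemptStart p.c₂ τ (n + 1 + 1) with hs'
  have hτs : (τ : ℝ) + 1 ≤ s := le_attemptStart hc τ _
  have hss' : s ≤ s' := attemptStart_le_succ hc τ _
  have hlen : s' - s = p.c₂ * 2 ^ (n + 1) := by
    rw [hs', hs, attemptStart_succ, attemptStart_succ]; ring
  have hlen' : s' = τ + 1 + p.c₂ * (2 ^ (n + 2) - 2) := attemptStart_succ _ _ _
  have hpow : (2 : ℝ) ≤ 2 ^ (n + 2) := by
    rw [pow_succ]; nlinarith [one_le_pow₀ (one_le_two (α := ℝ)) (n := n + 1)]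
  have hSle := hp.lintegral_stickyDrift_le hg.aestronglyMeasurable hsucc.1 h.stepOne
    (L := p.c₂ * (2 ^ (n + 2) - 2)) (mul_nonneg hc (by linarith))
  rw [← hlen'] at hSle
  have hSint : IntegrableOn (stickyDrift p q τ) (Ioc ((τ : ℝ) + 1) s') :=
    ⟨(aestronglyMeasurable_stickyDrift hg.aestronglyMeasurable τ).restrict,
      hSle.trans_lt ENNReal.ofReal_lt_top⟩
  have hlast := lintegral_attempt_le hc (hp.truncation_pos _) hg hW
    (hSint.mono_set (Ioc_subset_Ioc_left hτs)) htwo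
  have hmid : ∫⁻ t in Ioc ((τ : ℝ) + 1) s, ‖q.g t‖ₑ =
      ∫⁻ t in Ioc ((τ : ℝ) + 1) s, ‖stickyDrift p q τ t‖ₑ :=
    lintegral_congr_ae ((ae_eq_stickyDrift hc n hprev).mono fun t ht => by simp only [ht])
  set r := Real.sqrt (2 ^ (n + 1)) with hr
  have hr1 : 1 ≤ r := Real.one_le_sqrt.2 (one_le_pow₀ one_le_two)
  calc ∫⁻ t in Ioc (τ : ℝ) s', ‖q.g t‖ₑ
      = (∫⁻ t in Ioc (τ : ℝ) (τ + 1), ‖q.g t‖ₑ) + ((∫⁻ t in Ioc ((τ : ℝ) + 1) s, ‖q.g t‖ₑ) +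
        ∫⁻ t in Ioc s s', ‖q.g t‖ₑ) := by
        rw [← lintegral_union measurableSet_Ioc (Ioc_disjoint_Ioc_of_le le_rfl),
          Ioc_union_Ioc_eq_Ioc hτs hss',
          ← lintegral_union measurableSet_Ioc (Ioc_disjoint_Ioc_of_le le_rfl),
          Ioc_union_Ioc_eq_Ioc (by linarith) (hτs.trans hss')]
    _ ≤ ENNReal.ofReal p.stepOneBound + ((∫⁻ t in Ioc ((τ : ℝ) + 1) s, ‖stickyDrift p q τ t‖ₑ) +
        ((∫⁻ t in Ioc s s', ‖stickyDrift p q τ t‖ₑ) +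
          ENNReal.ofReal (Real.sqrt (s' - s) * p.truncation (n + 1)))) := by
        rw [hmid]
        exact add_le_add hone (add_le_add le_rfl hlast)
    _ = ENNReal.ofReal p.stepOneBound + ((∫⁻ t in Ioc ((τ : ℝ) + 1) s', ‖stickyDrift p q τ t‖ₑ) +
          ENNReal.ofReal (Real.sqrt (s' - s) * p.truncation (n + 1))) := by
        rw [← add_assoc (∫⁻ t in Ioc ((τ : ℝ) + 1) s, _),
          ← lintegral_union measurableSet_Ioc (Ioc_disjoint_Ioc_of_le le_rfl),
          Ioc_union_Ioc_eq_Ioc hτs hss']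
    _ ≤ ENNReal.ofReal p.stepOneBound + (ENNReal.ofReal (|p.abelConst| *
          (Real.sqrt (p.c₂ * (2 ^ (n + 2) - 2)) + columnMass p.H * p.stepOneBound)) +
          ENNReal.ofReal (Real.sqrt (s' - s) * p.truncation (n + 1))) := by
        gcongr
    _ = ENNReal.ofReal (p.stepOneBound + (|p.abelConst| *
          (Real.sqrt (p.c₂ * (2 ^ (n + 2) - 2)) + columnMass p.H * p.stepOneBound) +
          Real.sqrt (s' - s) * p.truncation (n + 1))) := by
        have := hp.truncation_pos (n + 1)
        rw [← ENNReal.ofReal_add (by positivity) (by positivity),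
          ← ENNReal.ofReal_add hN1 (by positivity)]
    _ ≤ _ := by
        refine ENNReal.ofReal_le_ofReal ?_
        have e1 : Real.sqrt (p.c₂ * (2 ^ (n + 2) - 2)) ≤ Real.sqrt (2 * p.c₂) * r := by
          rw [hr, ← Real.sqrt_mul (by positivity)]
          refine Real.sqrt_le_sqrt ?_
          rw [pow_succ]; nlinarith
        have e2 : Real.sqrt (s' - s) = Real.sqrt p.c₂ * r := by
          rw [hlen, Real.sqrt_mul hc]
        have e3 := hp.truncation_le (n + 1)
        set m : ℝ := 1 + ((n + 1 : ℕ) : ℝ) with hm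
        have hm1 : 1 ≤ m := by rw [hm]; linarith [(Nat.cast_nonneg (n + 1) : (0 : ℝ) ≤ _)]
        have hmr : 1 ≤ m * r := one_le_mul_of_one_le_of_one_le hm1 hr1
        have hrm : r ≤ m * r := le_mul_of_one_le_left (by positivity) hm1
        have hr0 : 0 ≤ r := by positivity
        rw [e2]
        calc _ = p.stepOneBound + |p.abelConst| *
              (Real.sqrt (p.c₂ * (2 ^ (n + 2) - 2)) + columnMass p.H * p.stepOneBound) +
              Real.sqrt p.c₂ * r * p.truncation (n + 1) := by ring
          _ ≤ p.stepOneBound * (m * r) + |p.abelConst| *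
              (Real.sqrt (2 * p.c₂) * (m * r) + columnMass p.H * p.stepOneBound * (m * r)) +
              Real.sqrt p.c₂ * r * (p.truncationRate * m) := by
              refine add_le_add (add_le_add (le_mul_of_one_le_right hN1 hmr) ?_) (by gcongr)
              exact mul_le_mul_of_nonneg_left (add_le_add (e1.trans (by gcongr))
                (le_mul_of_one_le_right (by positivity) hmr)) (abs_nonneg _)
          _ = _ := by unfold Params.trialBound; ring

/-! ### Decay of the memory of past trials -/

/-- The profile in `t` of the memory of a remote past; see `memKernel_le`. -/
noncomputable def memProfile (H e t : ℝ) : ℝ := t ^ (1 / 2 - H) * (1 + t) ^ (H - 3 / 2 + e)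

lemma memProfile_nonneg {H e t : ℝ} (ht : 0 < t) : 0 ≤ memProfile H e t := by
  unfold memProfile; positivity

/-- Memory at distance at least `D` is damped by `D ^ (-e)`, uniformly in `T`; a part of the decay
in `t` is spent on that. -/
lemma memKernel_le {H e T t s D : ℝ} (hH : 1 / 2 ≤ H) (he : 0 ≤ e) (heH : e ≤ 3 / 2 - H)
    (hT : 0 ≤ T) (ht : 0 < t) (hD : 1 ≤ D) (hs : s ≤ -D) :
    memKernel H T t s ≤ memProfile H e t * D ^ (-e) := by
  set v := T - s with hv
  have hvD : D ≤ v := by linarith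
  have hv0 : 0 < v := by linarith
  have htv : 0 < t + v := by linarith
  have h1 : v ^ (H - 1 / 2) ≤ (t + v) ^ (H - 1 / 2) :=
    Real.rpow_le_rpow hv0.le (by linarith) (by linarith)
  have h2 : (t + v) ^ (H - 1 / 2) / (t + v) = (t + v) ^ (H - 3 / 2 + e) * (t + v) ^ (-e) := by
    rw [← Real.rpow_add htv, ← Real.rpow_sub_one htv.ne']
    congr 1; ring
  have h3 : (t + v) ^ (H - 3 / 2 + e) ≤ (1 + t) ^ (H - 3 / 2 + e) :=
    Real.rpow_le_rpow_of_nonpos (by linarith) (by linarith) (by linarith)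
  have h4 : (t + v) ^ (-e) ≤ D ^ (-e) :=
    Real.rpow_le_rpow_of_nonpos (by linarith) (by linarith) (by linarith)
  rw [memKernel, memProfile, show t + T - s = t + v by rw [hv]; ring, mul_div_assoc, mul_assoc]
  refine mul_le_mul_of_nonneg_left ?_ (by positivity)
  calc v ^ (H - 1 / 2) / (t + v) ≤ (t + v) ^ (H - 1 / 2) / (t + v) := by gcongr
    _ = (t + v) ^ (H - 3 / 2 + e) * (t + v) ^ (-e) := h2
    _ ≤ (1 + t) ^ (H - 3 / 2 + e) * D ^ (-e) := by gcongr

/-- The weighted `L²` norm, squared, of the profile. -/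
noncomputable def profileMass (H α e : ℝ) : ℝ :=
  ∫ t in Ioi (0 : ℝ), (1 + t) ^ (2 * α) * memProfile H e t ^ 2

lemma lintegral_memProfile {H α e : ℝ} (hH : H ∈ Ioo (1 / 2) (1 : ℝ)) (he : e < 1 / 2 - α) :
    ∫⁻ t in Ioi (0 : ℝ), ENNReal.ofReal ((1 + t) ^ (2 * α) * memProfile H e t ^ 2) =
      ENNReal.ofReal (profileMass H α e) := by
  have hint := integrableOn_rpow_mul_one_add_rpow (a := 1 - 2 * H)
    (b := 2 * α + (2 * H - 3 + 2 * e)) (by linarith [hH.2]) (by linarith [hH.2]) (by linarith)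
  rw [profileMass, ofReal_integral_eq_lintegral_ofReal]
  · refine hint.congr_fun (fun t (ht : 0 < t) => ?_) measurableSet_Ioi
    have h1 : 0 < 1 + t := by linarith
    simp only [memProfile, mul_pow]
    rw [← Real.rpow_natCast, ← Real.rpow_natCast, ← Real.rpow_mul ht.le, ← Real.rpow_mul h1.le,
      Real.rpow_add h1]
    push_cast
    rw [show (1 / 2 - H) * 2 = 1 - 2 * H by ring,
      show (H - 3 / 2 + e) * 2 = 2 * H - 3 + 2 * e by ring]
    ring
  · filter_upwards [ae_restrict_mem measurableSet_Ioi] with t ht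
    have ht0 : 0 < t := ht
    positivity

lemma memoryCond_of_lintegral_le {H α e A : ℝ} {g : ℝ → Vec d} (hH : H ∈ Ioo (1 / 2) (1 : ℝ))
    (he : e < 1 / 2 - α) (hm : AEStronglyMeasurable g) (hA : 0 ≤ A)
    (hA1 : A ^ 2 * profileMass H α e ≤ 1)
    (h : ∀ T : ℝ, 0 ≤ T → ∀ t : ℝ, 0 < t →
      ∫⁻ s in Iic (0 : ℝ), ENNReal.ofReal (memKernel H T t s) * ‖g s‖ₑ ≤
        ENNReal.ofReal (memProfile H e t * A)) :
    MemoryCond H α g := by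
  have hnorm : ∀ T : ℝ, 0 ≤ T → ∀ t : ℝ, 0 < t →
      ∫⁻ s in Iic (0 : ℝ), ‖memKernel H T t s • g s‖ₑ ≤ ENNReal.ofReal (memProfile H e t * A) :=
    fun T hT t ht => (setLIntegral_congr_fun measurableSet_Iic fun s hs => by
      simp only [enorm_smul, Real.enorm_of_nonneg (memKernel_nonneg hT ht hs)]).le.trans (h T hT t ht)
  refine ⟨fun T hT t ht => ⟨((measurable_memKernel_right H T t).aestronglyMeasurable.smul
    hm).restrict, (hnorm T hT t ht).trans_lt ENNReal.ofReal_lt_top⟩, iSup_le fun T => ?_⟩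
  calc ∫⁻ t in Ioi (0 : ℝ), ENNReal.ofReal ((1 + t) ^ (2 * α)) * ‖memOp H (T : ℝ) g t‖ₑ ^ 2
      ≤ ∫⁻ t in Ioi (0 : ℝ), ENNReal.ofReal (A ^ 2) *
        ENNReal.ofReal ((1 + t) ^ (2 * α) * memProfile H e t ^ 2) := by
        refine setLIntegral_mono' measurableSet_Ioi fun t (ht : 0 < t) => ?_
        have h1 : ‖memOp H (T : ℝ) g t‖ₑ ≤ ENNReal.ofReal (memProfile H e t * A) :=
          (enorm_integral_le_lintegral_enorm _).trans (hnorm T T.2 t ht)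
        have h2 := memProfile_nonneg (H := H) (e := e) ht
        calc _ ≤ ENNReal.ofReal ((1 + t) ^ (2 * α)) *
              ENNReal.ofReal (memProfile H e t * A) ^ 2 := by gcongr
          _ = _ := by
            rw [← ENNReal.ofReal_pow (by positivity), ← ENNReal.ofReal_mul (by positivity),
              ← ENNReal.ofReal_mul (by positivity)]
            congr 1; ring
    _ = ENNReal.ofReal (A ^ 2 * profileMass H α e) := by
        rw [lintegral_const_mul' _ _ ENNReal.ofReal_ne_top, lintegral_memProfile hH he,
          ← ENNReal.ofReal_mul (by positivity)]
    _ ≤ 1 := ENNReal.ofReal_le_one.2 hA1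

/-- The duration of Step 3 after a failure of attempt `ℓ` outweighs the size of the drift. -/
lemma exists_forall_mul_rpow_le {β e : ℝ} (h : 1 / 2 < β * e) :
    ∃ B : ℝ, 0 ≤ B ∧ ∀ ℓ : ℕ, (1 + ℓ) * Real.sqrt (2 ^ ℓ) * ((2 : ℝ) ^ (β * ℓ)) ^ (-e) ≤ B := by
  set x : ℝ := (2 : ℝ) ^ (1 / 2 - β * e) with hx
  have hx0 : 0 ≤ x := by positivity
  have hx1 : x < 1 := Real.rpow_lt_one_of_one_lt_of_neg (by norm_num) (by linarith)
  have hlim : Filter.Tendsto (fun ℓ : ℕ => (1 + (ℓ : ℝ)) * x ^ ℓ) Filter.atTop (nhds 0) := by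
    have h1 := tendsto_pow_atTop_nhds_zero_of_lt_one hx0 hx1
    have h2 := tendsto_self_mul_const_pow_of_lt_one hx0 hx1
    simpa [add_mul] using h1.add h2
  obtain ⟨B, hB⟩ := hlim.bddAbove_range
  refine ⟨B, (by positivity : (0 : ℝ) ≤ (1 + ((0 : ℕ) : ℝ)) * x ^ 0).trans (hB ⟨0, rfl⟩),
    fun ℓ => le_trans (le_of_eq ?_) (hB ⟨ℓ, rfl⟩)⟩
  have e1 : Real.sqrt (2 ^ ℓ) = (2 : ℝ) ^ (1 / 2 * (ℓ : ℝ)) := by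
    rw [Real.sqrt_eq_rpow, ← Real.rpow_natCast, ← Real.rpow_mul (by norm_num), mul_comm]
  have e2 : x ^ ℓ = (2 : ℝ) ^ ((1 / 2 - β * e) * ℓ) := by
    rw [hx, Real.rpow_mul (by norm_num), Real.rpow_natCast]
  simp only
  rw [e1, e2, ← Real.rpow_mul (by norm_num), mul_assoc, ← Real.rpow_add (by norm_num)]
  congr 2; ring

/-- The trials up to the `k`-th contribute to the memory a geometric sum: the duration of Step 3
damps the contribution of trial `j` by `(c₃ ς^j) ^ (-e)`. -/
lemma Params.Valid.lintegral_memory_le (hp : p.Valid) {c₃ e B : ℝ} (hc₃ : 1 ≤ c₃) (he : 0 ≤ e)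
    (heH : e ≤ 3 / 2 - p.H)
    (hB : ∀ ℓ : ℕ, (1 + ℓ) * Real.sqrt (2 ^ ℓ) * ((2 : ℝ) ^ (p.β * ℓ)) ^ (-e) ≤ B)
    {q : Paths d} {τ : ℕ → WithTop ℝ≥0} (hg : LocallyIntegrable q.g)
    (hW : ∀ s t : ℝ, q.W 1 t - q.W 1 s = q.W 0 t - q.W 0 s + ∫ r in s..t, q.g r)
    (hstart : ∀ t : ℝ≥0, τ 0 = t → ∀ᵐ s ∂volume.restrict (Iic (t : ℝ)), q.g s = 0)
    (htrial : ∀ (k : ℕ) (t : ℝ≥0), τ k = t → FollowsTrial p c₃ (k + 1) q t (τ (k + 1)))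
    (habs : ∀ k, τ k = ⊤ → τ (k + 1) = ⊤) (k : ℕ) (t : ℝ≥0) (ht : τ k = t) {T x v : ℝ}
    (hT : 0 ≤ T) (hx : 0 < x) (hv : t ≤ v) :
    ∫⁻ s in Iic (t : ℝ), ENNReal.ofReal (memKernel p.H T x (s - v)) * ‖q.g s‖ₑ ≤
      ENNReal.ofReal (memProfile p.H e x * (p.trialBound * B * c₃ ^ (-e) *
        ∑ j ∈ Finset.range k, (p.ς ^ (-e)) ^ (j + 1))) := by
  induction k generalizing t with
  | zero =>
    rw [lintegral_congr_ae (g := fun _ => 0) ((hstart t ht).mono fun s hs => by simp [hs])]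
    simp
  | succ k ih =>
    obtain ⟨t₀, ht₀⟩ : ∃ t₀ : ℝ≥0, τ k = t₀ := by
      rcases hk : τ k with _ | t₀
      · rw [habs k hk] at ht; exact absurd ht (WithTop.top_ne_coe)
      · exact ⟨t₀, rfl⟩
    have hF := htrial k t₀ ht₀
    obtain ⟨ℓ, hℓ⟩ : ∃ ℓ, FailsAt p q t₀ ℓ := by
      by_contra! hno
      rw [hF.success hno] at ht
      exact absurd ht (WithTop.top_ne_coe)
    obtain ⟨t', ht', hdur, hzero⟩ := hF.stepThree ℓ hℓ
    obtain rfl : t = t' := WithTop.coe_injective (ht.symm.trans ht')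
    have hς := hp.hς
    have hβ : 0 ≤ p.β := (inv_nonneg.2 (by linarith [hp.hα.2])).trans hp.hβ.le
    have hH := hp.hH
    set s' := attemptStart p.c₂ t₀ (ℓ + 1) with hs'
    set D := p.stepThreeLength c₃ ℓ (k + 1) with hD
    have h2 : 1 ≤ (2 : ℝ) ^ (p.β * ℓ) := Real.one_le_rpow one_le_two (by positivity)
    have hςk : 1 ≤ p.ς ^ (k + 1) := one_le_pow₀ hς.le
    have hD1 : 1 ≤ D := one_le_mul_of_one_le_of_one_le (one_le_mul_of_one_le_of_one_le hc₃ hςk) h2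
    have hts' : (t₀ : ℝ) ≤ s' := by
      have := le_attemptStart (show 0 ≤ p.c₂ by linarith [hp.hc₂]) t₀ (ℓ + 1)
      linarith
    have hs't : s' ≤ t := by linarith
    have hΨ := memProfile_nonneg (H := p.H) (e := e) hx
    have hDe : D ^ (-e) = c₃ ^ (-e) * (p.ς ^ (-e)) ^ (k + 1) * ((2 : ℝ) ^ (p.β * ℓ)) ^ (-e) := by
      rw [hD, Params.stepThreeLength, Real.mul_rpow (by positivity) (by positivity),
        Real.mul_rpow (by positivity) (by positivity), ← Real.rpow_natCast p.ς,
        ← Real.rpow_natCast (p.ς ^ (-e)), ← Real.rpow_mul (by positivity) (_ : ℝ) (-e),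
        ← Real.rpow_mul (by positivity) (-e), mul_comm (-e)]
    have hmid : ∫⁻ s in Ioc (t₀ : ℝ) s', ENNReal.ofReal (memKernel p.H T x (s - v)) * ‖q.g s‖ₑ ≤
        ENNReal.ofReal (memProfile p.H e x * (p.trialBound * B * c₃ ^ (-e) *
          (p.ς ^ (-e)) ^ (k + 1))) := by
      calc _ ≤ ∫⁻ s in Ioc (t₀ : ℝ) s', ENNReal.ofReal (memProfile p.H e x * D ^ (-e)) *
            ‖q.g s‖ₑ := by
            refine setLIntegral_mono' measurableSet_Ioc fun s hs => ?_
            gcongr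
            exact memKernel_le hH.1.le he heH hT hx hD1 (by linarith [hs.2])
        _ ≤ ENNReal.ofReal (memProfile p.H e x * D ^ (-e)) *
            ENNReal.ofReal (p.trialBound * ((1 + ℓ) * Real.sqrt (2 ^ ℓ))) := by
            rw [lintegral_const_mul' _ _ ENNReal.ofReal_ne_top]
            gcongr
            exact hp.lintegral_trial_le hg hW hF hℓ
        _ ≤ _ := by
            rw [← ENNReal.ofReal_mul (by positivity), hDe]
            refine ENNReal.ofReal_le_ofReal ?_
            have htb := hp.trialBound_nonneg
            calc _ = memProfile p.H e x * (p.trialBound * ((1 + ℓ) * Real.sqrt (2 ^ ℓ) *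
                  ((2 : ℝ) ^ (p.β * ℓ)) ^ (-e)) * c₃ ^ (-e) * (p.ς ^ (-e)) ^ (k + 1)) := by ring
              _ ≤ _ := by gcongr; exact hB ℓ
    have hlast : ∫⁻ s in Ioc s' (t : ℝ), ENNReal.ofReal (memKernel p.H T x (s - v)) * ‖q.g s‖ₑ
        = 0 := by
      rw [lintegral_congr_ae (g := fun _ => 0) (hzero.mono fun s hs => by simp [hs])]
      simp
    have hB0 : 0 ≤ B := le_trans (by positivity) (hB 0)
    have htb := hp.trialBound_nonneg
    rw [← Iic_union_Ioc_eq_Iic (hts'.trans hs't), ← Ioc_union_Ioc_eq_Ioc hts' hs't]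
    refine (lintegral_union_le _ _ _).trans ((add_le_add (ih t₀ ht₀ (by linarith))
      ((lintegral_union_le _ _ _).trans (add_le_add hmid hlast.le))).trans (le_of_eq ?_))
    rw [add_zero, ← ENNReal.ofReal_add (by positivity) (by positivity), Finset.sum_range_succ]
    congr 1; ring

/-- The pathwise statement. The constant `c₃` depends only on the parameters: it makes the geometric
sum over all trials small against the mass of the profile. -/
lemma Params.Valid.exists_forall_memoryCond (hp : p.Valid) :
    ∃ c₃ : ℝ, 2 * p.c₂ ≤ c₃ ∧ ∀ (q : Paths d) (τ : ℕ → WithTop ℝ≥0), LocallyIntegrable q.g →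
      (∀ s t : ℝ, q.W 1 t - q.W 1 s = q.W 0 t - q.W 0 s + ∫ r in s..t, q.g r) →
      (∀ t : ℝ≥0, τ 0 = t → ∀ᵐ s ∂volume.restrict (Iic (t : ℝ)), q.g s = 0) →
      (∀ (k : ℕ) (t : ℝ≥0), τ k = t → FollowsTrial p c₃ (k + 1) q t (τ (k + 1))) →
      (∀ k, τ k = ⊤ → τ (k + 1) = ⊤) →
      ∀ (k : ℕ) (t : ℝ≥0), τ k = t → MemoryCond p.H p.α (fun s => q.g (s + t)) := by
  have hα : 0 < 1 - 2 * p.α := by linarith [hp.hα.2]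
  have hβ0 : 0 < p.β := (inv_pos.2 hα).trans hp.hβ
  have hβ1 : 1 / 2 < p.β * (1 / 2 - p.α) := by
    have := (inv_lt_iff_one_lt_mul₀ hα).1 hp.hβ
    linarith
  -- `e` strictly between `1/(2β)` and `1/2 - α`
  obtain ⟨e, he1, he2⟩ := exists_between (show 1 / 2 / p.β < 1 / 2 - p.α by
    rwa [div_lt_iff₀' hβ0])
  rw [div_lt_iff₀' hβ0] at he1
  have he0 : 0 < e := pos_of_mul_pos_right (one_half_pos.trans he1) hβ0.le
  have heH : e ≤ 3 / 2 - p.H := by linarith [hp.hH.2, hp.hα.1]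
  obtain ⟨B, hB0, hB⟩ := exists_forall_mul_rpow_le he1
  set r := p.ς ^ (-e) with hr
  have hr0 : 0 ≤ r := Real.rpow_nonneg (by linarith [hp.hς]) _
  have hr1 : r < 1 := Real.rpow_lt_one_of_one_lt_of_neg hp.hς (by linarith)
  have hsum : ∀ k, ∑ j ∈ Finset.range k, r ^ (j + 1) ≤ (1 - r)⁻¹ := fun k => by
    rw [← tsum_geometric_of_lt_one hr0 hr1]
    refine (Finset.sum_le_sum fun j _ => pow_le_pow_of_le_one hr0 hr1.le (Nat.le_succ j)).trans ?_
    exact (summable_geometric_of_lt_one hr0 hr1).sum_le_tsum _ fun j _ => pow_nonneg hr0 j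
  have hr1' : 0 < 1 - r := sub_pos.2 hr1
  have htb := hp.trialBound_nonneg
  have hlim : Filter.Tendsto (fun c : ℝ => (p.trialBound * B * c ^ (-e) * (1 - r)⁻¹) ^ 2 *
      profileMass p.H p.α e) Filter.atTop (nhds 0) := by
    have := ((((tendsto_rpow_neg_atTop he0).const_mul (p.trialBound * B)).mul_const
      (1 - r)⁻¹).pow 2).mul_const (profileMass p.H p.α e)
    simpa using this
  obtain ⟨c₃, hsmall, hc₃⟩ := ((hlim.eventually_le_const zero_lt_one).and
    (Filter.eventually_ge_atTop (2 * p.c₂))).exists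
  have hc₃1 : 1 ≤ c₃ := by linarith [hp.hc₂]
  refine ⟨c₃, hc₃, fun q τ hg hW hstart htrial habs k t ht => ?_⟩
  refine memoryCond_of_lintegral_le hp.hH he2
    (aestronglyMeasurable_comp_add_right hg.aestronglyMeasurable t)
    (A := p.trialBound * B * c₃ ^ (-e) * (1 - r)⁻¹) (by positivity) hsmall fun T hT x hx => ?_
  have key := hp.lintegral_memory_le hc₃1 he0.le heH hB hg hW hstart htrial habs k t ht hT hx le_rfl
  have hshift := setLIntegral_Iic_comp_add_right
    (fun s => ENNReal.ofReal (memKernel p.H T x (s - t)) * ‖q.g s‖ₑ) 0 t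
  simp only [add_sub_cancel_right, zero_add] at hshift
  rw [hshift]
  refine key.trans (ENNReal.ofReal_le_ofReal ?_)
  have hΨ := memProfile_nonneg (H := p.H) (e := e) hx
  gcongr
  exact hsum k

end FracCoupling

theorem proposition4p10 {d : ℕ} (p : FracCoupling.Params d) (hp : p.Valid) :
    ∃ c₃ : ℝ, 2 * p.c₂ ≤ c₃ ∧
      ∀ (Ω : Type*) (mΩ : MeasurableSpace Ω) (P : Measure Ω) (_ : IsProbabilityMeasure P)
        (𝓕 : Filtration ℝ≥0 mΩ) (W X : Fin 2 → ℝ → Ω → FracCoupling.Vec d)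
        (g : ℝ → Ω → FracCoupling.Vec d) (τ : ℕ → Ω → WithTop ℝ≥0),
        FracCoupling.IsCouplingScheme p c₃ P 𝓕 W X g τ →
        ∀ k : ℕ,
          (∀ᵐ ω ∂P, ∀ t : ℝ≥0, τ k ω = t →
            FracCoupling.MemoryCond p.H p.α (fun s => g (s + t) ω)) ∧
          (P {ω | τ k ω < ⊤} ≠ 0 →
            ProbabilityTheory.cond P {ω | τ k ω < ⊤}
              {ω | ∃ t : ℝ≥0, τ k ω = t ∧
                FracCoupling.MemoryCond p.H p.α (fun s => g (s + t) ω)} = 1) := by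
  obtain ⟨c₃, hc₃, hmem⟩ := hp.exists_forall_memoryCond
  refine ⟨c₃, hc₃, fun Ω mΩ P _ 𝓕 W X g τ hS k => ?_⟩
  have hae : ∀ᵐ ω ∂P, ∀ t : ℝ≥0, τ k ω = t →
      FracCoupling.MemoryCond p.H p.α (fun s => g (s + t) ω) := by
    filter_upwards [hS.drift, hS.start, hS.trial, hS.absorbed] with ω hdrift hstart htrial habs
    exact hmem ⟨fun i s => W i s ω, fun i s => X i s ω, fun s => g s ω⟩ (fun k => τ k ω) hdrift.1
      hdrift.2 (fun t ht => (hstart t ht).2) htrial habs k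
  refine ⟨hae, fun hpos => ?_⟩
  have hms : MeasurableSet {ω | τ k ω < ⊤} := by
    have e : {ω | τ k ω < ⊤} = ⋃ n : ℕ, {ω | τ k ω ≤ ((n : ℝ≥0) : WithTop ℝ≥0)} := by
      ext ω
      simp only [mem_ofPred_eq, mem_iUnion]
      constructor
      · intro h
        obtain ⟨t, ht⟩ := WithTop.ne_top_iff_exists.1 h.ne
        obtain ⟨n, hn⟩ := exists_nat_ge t
        exact ⟨n, by rw [← ht]; exact_mod_cast hn⟩
      · rintro ⟨n, hn⟩
        exact hn.trans_lt (WithTop.coe_lt_top _)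
    rw [e]
    exact MeasurableSet.iUnion fun n => 𝓕.le _ _ (hS.stopping k _)
  rw [ProbabilityTheory.cond_apply hms]
  have e : P ({ω | τ k ω < ⊤} ∩ {ω | ∃ t : ℝ≥0, τ k ω = t ∧
      FracCoupling.MemoryCond p.H p.α (fun s => g (s + t) ω)}) = P {ω | τ k ω < ⊤} := by
    refine measure_congr (hae.mono fun ω hω => propext ⟨fun h => h.1, fun h => ⟨h, ?_⟩⟩)
    obtain ⟨t, ht⟩ := WithTop.ne_top_iff_exists.1 (ne_of_lt h)
    exact ⟨t, ht.symm, hω t ht.symm⟩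
  rw [e, ENNReal.inv_mul_cancel hpos (measure_ne_top P _)]
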